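/- Let $\mathbf{k}$ be an algebraically closed field (of any characteristic). Let $\mathrm{Aut}(\mathbb{A}^2_{\mathbf k})$ be the group of polynomial automorphisms $f=(f_1,f_2)$ of the affine plane, with $\deg(f)=\max(\deg f_1,\deg f_2)$, and let $\mathrm{SAut}(\mathbb{A}^2_{\mathbf k})$ be the subgroup of automorphisms with Jacobian determinant $1$. The group $\mathrm{Aut}(\mathbb{A}^2_{\mathbf k})$ carries the Zariski topology: a subset is closed if and only if its preimage under every morphism $A\to\mathrm{Aut}(\mathbb{A}^2_{\mathbf k})$ from an algebraic variety $A$ over $\mathbf k$ (that is, every map $A\to\mathrm{Aut}(\mathbb{A}^2_{\mathbf k})$ given by an $A$-automorphism of $A\times\mathbb{A}^2_{\mathbf k}$) is closed in $A$; the subgroup $\mathrm{SAut}(\mathbb{A}^2_{\mathbf k})$ carries the induced topology. Call $f\in\mathrm{Aut}(\mathbb{A}^2_{\mathbf k})$ dynamically regular if $\deg(f)\ge 2$ and the indeterminacy loci in $\mathbb{P}^2_{\mathbf k}$ of the extensions of $f$ and $f^{-1}$ to rational maps $\mathbb{P}^2_{\mathbf k}\dashrightarrow\mathbb{P}^2_{\mathbf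 k}$ (via $(x_1,x_2)\mapsto[1:x_1:x_2]$) are disjoint. Let $f\in\mathrm{SAut}(\mathbb{A}^2_{\mathbf k})$ be dynamically regular. Then: (1) if $g\in\mathrm{SAut}(\mathbb{A}^2_{\mathbf k})$ is conjugate to $f$ in $\mathrm{SAut}(\mathbb{A}^2_{\mathbf k})$, there exists $h\in\mathrm{SAut}(\mathbb{A}^2_{\mathbf k})$ such that $g=hfh^{-1}$ and $\deg(h)^2\le\deg(g)$; (2) the conjugacy class of $f$ in $\mathrm{SAut}(\mathbb{A}^2_{\mathbf k})$ is closed in $\mathrm{SAut}(\mathbb{A}^2_{\mathbf k})$. -/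

import Mathlib

universe u

noncomputable section

namespace AffineAut

open MvPolynomial CategoryTheory AlgebraicGeometry

/-! ### Endomorphisms and automorphisms of affine space -/

/-- The set `End(𝔸ⁿ_R)` of algebraic endomorphisms
`(x₁, …, xₙ) ↦ (f₁(x₁, …, xₙ), …, fₙ(x₁, …, xₙ))` of affine `n`-space over `R`. -/
@[ext]
structure PolyEnd (n : ℕ) (R : Type u) [CommRing R] where
  /-- The components `f₁, …, fₙ`. -/
  comp : Fin n → MvPolynomial (Fin n) R

namespace PolyEnd

variable {n : ℕ} {R : Type u} [CommRing R]

/-- The product `f * g` is the composition `f ∘ g`. -/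
instance : Monoid (PolyEnd n R) where
  mul f g := ⟨fun i => bind₁ g.comp (f.comp i)⟩
  one := ⟨X⟩
  mul_assoc f g h := by
    ext1
    funext i
    exact bind₁_bind₁ g.comp h.comp (f.comp i)
  one_mul f := by
    ext1
    funext i
    exact bind₁_X_right f.comp i
  mul_one f := by
    ext1
    funext i
    exact congrArg (fun φ : MvPolynomial (Fin n) R →ₐ[R] MvPolynomial (Fin n) R => φ (f.comp i))
      (aeval_X_left (R := R) (σ := Fin n))

theorem mul_comp (f g : PolyEnd n R) (i : Fin n) :
    (f * g).comp i = bind₁ g.comp (f.comp i) := rfl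

theorem one_comp (i : Fin n) : (1 : PolyEnd n R).comp i = X i := rfl

/-- The value `f(x)` at a point `x ∈ Rⁿ`. -/
def evalAt (f : PolyEnd n R) (x : Fin n → R) : Fin n → R := fun i => eval x (f.comp i)

/-- The degree of `f`: the maximal degree of its components. -/
def deg (f : PolyEnd n R) : ℕ := Finset.univ.sup fun i => (f.comp i).totalDegree

/-- The Jacobian determinant `det (∂fᵢ/∂xⱼ)`. -/
def jac (f : PolyEnd n R) : MvPolynomial (Fin n) R :=
  (Matrix.of fun i j : Fin n => pderiv j (f.comp i)).det

theorem pderiv_bind₁ (g : Fin n → MvPolynomial (Fin n) R) (j : Fin n)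
    (p : MvPolynomial (Fin n) R) :
    pderiv j (bind₁ g p) = ∑ i, bind₁ g (pderiv i p) * pderiv j (g i) := by
  induction p using MvPolynomial.induction_on with
  | C a => simp
  | add p q hp hq => simp [hp, hq, add_mul, Finset.sum_add_distrib]
  | mul_X p k hp =>
    simp only [map_mul, bind₁_X_right, pderiv_mul, hp, map_add, add_mul, Finset.sum_add_distrib,
      Finset.sum_mul]
    congr 1
    · exact Finset.sum_congr rfl fun i _ => by ring
    · rw [Finset.sum_eq_single k]
      · simp
      · intro b _ hb
        simp [pderiv_X_of_ne (Ne.symm hb)]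
      · simp

theorem jac_mul (f g : PolyEnd n R) : (f * g).jac = bind₁ g.comp f.jac * g.jac := by
  unfold jac
  rw [AlgHom.map_det, ← Matrix.det_mul]
  congr 1
  ext1 i j
  simp [mul_comp, pderiv_bind₁, Matrix.mul_apply]

theorem jac_one : (1 : PolyEnd n R).jac = 1 := by
  unfold jac
  rw [← Matrix.det_one (n := Fin n)]
  congr 1
  ext1 i j
  simp [one_comp, pderiv_X, Matrix.one_apply, Pi.single_apply]

end PolyEnd

/-- The group `Aut(𝔸ⁿ_R)`: the endomorphisms admitting an inverse endomorphism. -/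
abbrev PolyAut (n : ℕ) (R : Type u) [CommRing R] : Type u := (PolyEnd n R)ˣ

/-- The subgroup `SAut(𝔸ⁿ_R)` of automorphisms with Jacobian determinant `1`. -/
def SAut (n : ℕ) (R : Type u) [CommRing R] : Subgroup (PolyAut n R) where
  carrier := {f | (f : PolyEnd n R).jac = 1}
  mul_mem' {f g} hf hg := by
    simp only [Set.mem_ofPred_eq] at hf hg ⊢
    simp [PolyEnd.jac_mul, hf, hg]
  one_mem' := by simp [PolyEnd.jac_one]
  inv_mem' {f} hf := by
    simp only [Set.mem_ofPred_eq] at hf ⊢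
    have h := PolyEnd.jac_mul (f : PolyEnd n R) (↑f⁻¹ : PolyEnd n R)
    rw [Units.mul_inv, PolyEnd.jac_one, hf, map_one, one_mul] at h
    exact h.symm

/-! ### The behaviour at infinity -/

section Infinity

variable {k : Type u} [Field k]

/-- A tuple `(h₀, …, hₘ)` of homogeneous polynomials of the same degree, not all zero, gives the
rational map `[h₀ : … : hₘ]` from `ℙⁿ` to `ℙᵐ`. It is defined at the point `p` if the same
rational map can be written as `[q₀ : … : qₘ]` with homogeneous `qᵢ` of a common degree which do
not all vanish at `p`. The indeterminacy locus is the set of points where it is not defined. -/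
def indeterminacyLocus {n m : ℕ} (h : Fin (m + 1) → MvPolynomial (Fin (n + 1)) k) :
    Set (Projectivization k (Fin (n + 1) → k)) :=
  {p | ¬ ∃ (e : ℕ) (q : Fin (m + 1) → MvPolynomial (Fin (n + 1)) k),
    (∀ i, (q i).IsHomogeneous e) ∧ (∀ i j, q i * h j = q j * h i) ∧
      ∃ i, eval p.rep (q i) ≠ 0}

/-- `x₀ᵈ p(x₁/x₀, …, xₙ/x₀)`, for `p` of degree at most `d`. -/
def homogenize {n : ℕ} (d : ℕ) (p : MvPolynomial (Fin n) k) : MvPolynomial (Fin (n + 1)) k :=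
  ∑ j ∈ Finset.range (d + 1), X 0 ^ (d - j) * rename Fin.succ (homogeneousComponent j p)

/-- The homogeneous polynomials of degree `d = deg f` that give the extension of `f` to a rational
map from `ℙⁿ` to `ℙⁿ`, namely `[x₀ᵈ : x₀ᵈ f₁(x/x₀) : … : x₀ᵈ fₙ(x/x₀)]`, along the embedding
`(x₁, …, xₙ) ↦ [1 : x₁ : … : xₙ]`. -/
def PolyEnd.projExtension {n : ℕ} (f : PolyEnd n k) :
    Fin (n + 1) → MvPolynomial (Fin (n + 1)) k :=
  Fin.cons (X 0 ^ f.deg) fun i => homogenize f.deg (f.comp i)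

/-- An automorphism `f` of `𝔸ⁿ`, of degree at least `2`, is dynamically regular if the
indeterminacy loci of the extensions of `f` and `f⁻¹` to `ℙⁿ` are disjoint. -/
def DynamicallyRegular {n : ℕ} (f : PolyAut n k) : Prop :=
  2 ≤ (f : PolyEnd n k).deg ∧
    Disjoint (indeterminacyLocus (f : PolyEnd n k).projExtension)
      (indeterminacyLocus (↑f⁻¹ : PolyEnd n k).projExtension)

end Infinity

/-! ### The Zariski topology on the automorphism group -/

section Topology

/-- An algebraic variety over `k`: a reduced separated scheme of finite type over `k`
(not necessarily irreducible). -/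
structure Variety (k : Type u) [Field k] where
  /-- The underlying scheme. -/
  scheme : Scheme.{u}
  /-- The structure morphism. -/
  str : scheme ⟶ Spec (CommRingCat.of k)
  locallyOfFiniteType : LocallyOfFiniteType str
  quasiCompact : QuasiCompact str
  isSeparated : IsSeparated str
  isReduced : IsReduced scheme

variable {k : Type u} [Field k]

/-- The `k`-points of the variety `A`. -/
def Variety.Point (A : Variety k) : Type u :=
  {a : Spec (CommRingCat.of k) ⟶ A.scheme // a ≫ A.str = 𝟙 _}

/-- The point of the underlying topological space of `A` given by a `k`-point. -/
def Variety.Point.pt {A : Variety k} (a : A.Point) : A.scheme :=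
  a.1 (IsLocalRing.closedPoint k)

/-- The Zariski topology on the `k`-points of `A`. -/
instance (A : Variety k) : TopologicalSpace A.Point :=
  TopologicalSpace.induced Variety.Point.pt inferInstance

/-- The `k`-point `(a, x)` of `A × 𝔸ⁿ`. -/
def Variety.Point.pair {n : ℕ} {A : Variety k} (a : A.Point) (x : Fin n → k) :
    Spec (CommRingCat.of k) ⟶ 𝔸(ULift.{u} (Fin n); A.scheme) :=
  AffineSpace.homOfVector a.1 fun i =>
    (Scheme.ΓSpecIso (CommRingCat.of k)).inv (x i.down)

/-- A map `F` from the points of `A` to `Aut(𝔸ⁿ)` is a morphism if it is given by an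
`A`-automorphism `φ` of `A × 𝔸ⁿ`, that is, `φ(a, x) = (a, F(a)(x))`. -/
def IsMorphism {n : ℕ} (A : Variety k) (F : A.Point → PolyAut n k) : Prop :=
  ∃ φ : 𝔸(ULift.{u} (Fin n); A.scheme) ≅ 𝔸(ULift.{u} (Fin n); A.scheme),
    φ.hom ≫ 𝔸(ULift.{u} (Fin n); A.scheme) ↘ A.scheme =
      𝔸(ULift.{u} (Fin n); A.scheme) ↘ A.scheme ∧
    ∀ (a : A.Point) (x : Fin n → k),
      a.pair x ≫ φ.hom = a.pair ((F a : PolyEnd n k).evalAt x)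

/-- The Zariski topology on `Aut(𝔸ⁿ)`: a set is closed if and only if its preimage under every
morphism from an algebraic variety to `Aut(𝔸ⁿ)` is closed. -/
instance zariskiTopology (n : ℕ) : TopologicalSpace (PolyAut n k) :=
  TopologicalSpace.ofClosed
    {C | ∀ (A : Variety k) (F : A.Point → PolyAut n k), IsMorphism A F → IsClosed (F ⁻¹' C)}
    (fun A F _ => by simp)
    (fun S hS A F hF => by
      rw [Set.sInter_eq_biInter, Set.preimage_iInter₂]
      exact isClosed_biInter fun C hC => hS hC A F hF)
    (fun C hC D hD A F hF => by
      rw [Set.preimage_union]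
      exact (hC A F hF).union (hD A F hF))

theorem isClosed_polyAut_iff {n : ℕ} (C : Set (PolyAut n k)) :
    IsClosed C ↔ ∀ (A : Variety k) (F : A.Point → PolyAut n k),
      IsMorphism A F → IsClosed (F ⁻¹' C) := by
  rw [← isOpen_compl_iff]
  change Cᶜᶜ ∈ {C : Set (PolyAut n k) | ∀ (A : Variety k) (F : A.Point → PolyAut n k),
    IsMorphism A F → IsClosed (F ⁻¹' C)} ↔ _
  rw [compl_compl]
  rfl

end Topology

end AffineAut

end

/-! An automorphism `f` of degree `d ≥ 2` has top part `(a₀ ℓᵈ, a₁ ℓᵈ)` for a linear form `ℓ`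
(`IsTop`): at infinity it is undefined only at the zero of `ℓ` and contracts the rest of the line to
the point `a`. This is proved without a structure theorem for the group. The curve `fᵢ = 0` is
parametrised by a line through `f⁻¹`, and dimension counts on this curve give `deg f = deg f⁻¹` and
show that the top form of a component of degree `d` is a power of a linear form. The components are
proportional because the top parts of `f` and `f⁻¹` compose to zero.

For (1), degrees multiply in `h * f` unless `f` contracts infinity to the indeterminacy point of
`h`. Let `h` have minimal degree among the conjugators from `f` to `g`; then neither `h * f` nor `h
* f⁻¹` has smaller degree. If `deg g < deg(h)²`, this forces `f`, `f⁻¹` and `h⁻¹` to contract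
infinity to the same point (`deg_sq_le_or_exists`). That point is then an indeterminacy point of
both `f` and `f⁻¹`, which regularity excludes.

For (2), take a family over an affine chart with ring `B`. By (1) the conjugators over the
parameters in the conjugacy class have bounded degree, so they form one conjugator over a product of
copies of `k`, hence over a field `K` (`IsConjugator.exists_of_closure`). A parameter in the closure
is the centre of a valuation ring `O` of `K`. Regularity makes `f` or `f⁻¹` expand every point
outside the unit polydisc, so the inverse conjugator has coefficients in `O`
(`coeff_mem_of_semiconj`); Jacobian `1` gives the same for the conjugator
(`coeff_mem_of_mul_eq_one`). Reduction to the residue field and the Nullstellensatz yield a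
conjugator over `k`. -/

noncomputable section

namespace AffineAut

open MvPolynomial

/-! ### Top homogeneous parts of products and compositions. -/

section Homogeneous

variable {σ τ R : Type*} [CommRing R]

theorem coeff_eq_zero_of_totalDegree_lt_degree {p : MvPolynomial σ R} {s : σ →₀ ℕ}
    (h : p.totalDegree < s.degree) : coeff s p = 0 :=
  coeff_eq_zero_of_totalDegree_lt h

theorem homogeneousComponent_mul_of_le {p q : MvPolynomial σ R} {m n : ℕ}
    (hp : p.totalDegree ≤ m) (hq : q.totalDegree ≤ n) :
    homogeneousComponent (m + n) (p * q) =
      homogeneousComponent m p * homogeneousComponent n q := by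
  classical
  ext s
  rw [coeff_homogeneousComponent]
  split_ifs with hs
  · rw [coeff_mul, coeff_mul]
    refine Finset.sum_congr rfl fun x hx => ?_
    rw [Finset.HasAntidiagonal.mem_antidiagonal] at hx
    have hd : x.1.degree + x.2.degree = m + n := by rw [← map_add, hx, hs]
    rw [coeff_homogeneousComponent, coeff_homogeneousComponent]
    by_cases h1 : x.1.degree = m
    · rw [if_pos h1, if_pos (by omega)]
    · rw [if_neg h1, zero_mul]
      rcases lt_or_gt_of_ne h1 with h | h
      · rw [coeff_eq_zero_of_totalDegree_lt_degree (p := q) (by omega), mul_zero]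
      · rw [coeff_eq_zero_of_totalDegree_lt_degree (p := p) (by omega), zero_mul]
  · symm
    by_contra h
    refine hs ?_
    rw [Finsupp.degree_eq_weight_one]
    exact ((homogeneousComponent_isHomogeneous m p).mul
      (homogeneousComponent_isHomogeneous n q)) h

theorem homogeneousComponent_pow_of_le {p : MvPolynomial σ R} {m : ℕ}
    (hp : p.totalDegree ≤ m) (j : ℕ) :
    homogeneousComponent (j * m) (p ^ j) = homogeneousComponent m p ^ j := by
  induction j with
  | zero => simp
  | succ j ih =>
    rw [pow_succ, pow_succ, Nat.succ_mul, homogeneousComponent_mul_of_le _ hp, ih]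
    exact (totalDegree_pow _ _).trans (Nat.mul_le_mul le_rfl hp)

theorem homogeneousComponent_prod_of_le {ι : Type*} (s : Finset ι) {p : ι → MvPolynomial σ R}
    {m : ι → ℕ} (hp : ∀ i ∈ s, (p i).totalDegree ≤ m i) :
    homogeneousComponent (∑ i ∈ s, m i) (∏ i ∈ s, p i) =
      ∏ i ∈ s, homogeneousComponent (m i) (p i) := by
  classical
  induction s using Finset.induction_on with
  | empty => simp
  | insert a s ha ih =>
    rw [Finset.sum_insert ha, Finset.prod_insert ha, Finset.prod_insert ha,
      homogeneousComponent_mul_of_le (hp a (Finset.mem_insert_self _ _)),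
      ih fun i hi => hp i (Finset.mem_insert_of_mem hi)]
    exact (totalDegree_finsetProd _ _).trans
      (Finset.sum_le_sum fun i hi => hp i (Finset.mem_insert_of_mem hi))

theorem totalDegree_bind₁_le {f : σ → MvPolynomial τ R} {d : ℕ}
    (hf : ∀ i, (f i).totalDegree ≤ d) {G : MvPolynomial σ R} {e : ℕ} (hG : G.totalDegree ≤ e) :
    (bind₁ f G).totalDegree ≤ e * d := by
  rw [← aeval_eq_bind₁, aeval_def, eval₂_eq]
  refine totalDegree_finsetSum_le fun s hs => ?_
  refine (totalDegree_mul _ _).trans ?_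
  rw [algebraMap_eq, totalDegree_C, zero_add]
  refine (totalDegree_finsetProd _ _).trans ?_
  calc _ ≤ ∑ i ∈ s.support, s i * d := Finset.sum_le_sum fun i _ =>
        (totalDegree_pow _ _).trans (Nat.mul_le_mul le_rfl (hf i))
    _ = (∑ i ∈ s.support, s i) * d := by rw [Finset.sum_mul]
    _ ≤ e * d := Nat.mul_le_mul ((le_totalDegree hs).trans hG) le_rfl

/-- Monomials of `G` of degree below `e` contribute degree below `e * d`; this is where `0 < d`
enters. -/
theorem homogeneousComponent_bind₁ {f : σ → MvPolynomial τ R} {d : ℕ} (hd : 0 < d)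
    (hf : ∀ i, (f i).totalDegree ≤ d) {G : MvPolynomial σ R} {e : ℕ} (hG : G.totalDegree ≤ e) :
    homogeneousComponent (e * d) (bind₁ f G) =
      bind₁ (fun i => homogeneousComponent d (f i)) (homogeneousComponent e G) := by
  conv_lhs => rw [G.as_sum]
  conv_rhs => rw [G.as_sum]
  simp only [map_sum]
  refine Finset.sum_congr rfl fun s hs => ?_
  have hse : s.degree ≤ e := (le_totalDegree hs).trans hG
  rcases hse.lt_or_eq with h | h
  · rw [homogeneousComponent_eq_zero e (monomial s (coeff s G)), map_zero,
      homogeneousComponent_eq_zero]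
    · exact (totalDegree_bind₁_le hf (totalDegree_monomial_le _ _)).trans_lt
        (Nat.mul_lt_mul_of_pos_right h hd)
    · exact (totalDegree_monomial_le _ _).trans_lt h
  · have : homogeneousComponent e (monomial s (coeff s G)) = monomial s (coeff s G) :=
      homogeneousComponent_eq_self (isHomogeneous_monomial _ h)
    rw [this, bind₁_monomial, bind₁_monomial, homogeneousComponent_C_mul]
    congr 1
    have h2 : e * d = ∑ i ∈ s.support, s i * d := by
      rw [← Finset.sum_mul, ← h]; rfl
    rw [h2, homogeneousComponent_prod_of_le _ fun i _ =>
      (totalDegree_pow _ _).trans (Nat.mul_le_mul le_rfl (hf i))]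
    exact Finset.prod_congr rfl fun i _ => homogeneousComponent_pow_of_le (hf i) _

theorem homogeneousComponent_totalDegree_ne_zero {p : MvPolynomial σ R} (hp : p ≠ 0) :
    homogeneousComponent p.totalDegree p ≠ 0 := by
  obtain ⟨s, hs, h⟩ := Finset.exists_mem_eq_sup p.support (support_nonempty.2 hp)
    (fun s => s.sum fun _ e => e)
  intro h0
  have := coeff_homogeneousComponent p.totalDegree p s
  rw [h0, coeff_zero, if_pos (show s.degree = p.totalDegree from h.symm)] at this
  exact mem_support_iff.1 hs this.symm

end Homogeneous

/-! ### The dimension of the space of plane polynomials of bounded degree. -/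

section Hilbert

variable (k : Type*) [Field k]

theorem finrank_restrictTotalDegree (N : ℕ) :
    2 * Module.finrank k (restrictTotalDegree (Fin 2) k N) = (N + 1) * (N + 2) := by
  have e : {n : Fin 2 →₀ ℕ | (n.sum fun _ e => e) ≤ N} ≃
      ((Finset.range (N + 1)).sigma fun n => Finset.HasAntidiagonal.antidiagonal n : Finset (Σ _ : ℕ, ℕ × ℕ)) :=
    { toFun := fun s => ⟨⟨s.1 0 + s.1 1, (s.1 0, s.1 1)⟩, by
        have := s.2
        simp only [Set.mem_ofPred_eq, Finsupp.sum_fintype, implies_true, Fin.sum_univ_two] at this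
        simp
        omega⟩
      invFun := fun x => ⟨Finsupp.equivFunOnFinite.symm ![x.1.2.1, x.1.2.2], by
        obtain ⟨⟨n, a, b⟩, h⟩ := x
        simp only [Finset.mem_sigma, Finset.mem_range,
          Finset.HasAntidiagonal.mem_antidiagonal] at h
        simp [Finsupp.sum_fintype]
        omega⟩
      left_inv := fun s => by
        ext i
        fin_cases i <;> simp
      right_inv := fun x => by
        obtain ⟨⟨n, a, b⟩, h⟩ := x
        simp at h
        obtain ⟨h1, rfl⟩ := h
        simp }
  have h : Module.finrank k (restrictTotalDegree (Fin 2) k N) = ∑ n ∈ Finset.range (N + 1), (n + 1) := by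
    rw [restrictTotalDegree, Module.finrank_eq_nat_card_basis (basisRestrictSupport k _),
      Nat.card_congr e, Nat.card_eq_fintype_card, Fintype.card_coe, Finset.card_sigma]
    simp
  rw [h]
  clear h e
  induction N with
  | zero => simp
  | succ N ih => rw [Finset.sum_range_succ, mul_add, ih]; ring

end Hilbert

/-! ### Binary linear forms and divisors of their powers. -/

section LinearForm

variable {k : Type*} [Field k]

/-- The linear form `a₀ x₀ + a₁ x₁`. -/
def linForm (a : Fin 2 → k) : MvPolynomial (Fin 2) k := C (a 0) * X 0 + C (a 1) * X 1

theorem eval_linForm (a v : Fin 2 → k) : eval v (linForm a) = a 0 * v 0 + a 1 * v 1 := by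
  simp [linForm]

theorem isHomogeneous_linForm (a : Fin 2 → k) : (linForm a).IsHomogeneous 1 := by
  unfold linForm
  refine IsHomogeneous.add ?_ ?_ <;>
  simpa using (isHomogeneous_C (Fin 2) _).mul (isHomogeneous_X k _)

theorem coeff_linForm (a : Fin 2 → k) (i : Fin 2) :
    coeff (Finsupp.single i 1) (linForm a) = a i := by
  fin_cases i <;> simp [linForm, coeff_C_mul, coeff_X, Finsupp.single_left_inj]

theorem linForm_ne_zero {a : Fin 2 → k} (ha : a ≠ 0) : linForm a ≠ 0 := by
  intro h
  refine ha (funext fun i => ?_)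
  rw [← coeff_linForm a i, h]
  simp

theorem prime_linForm {a : Fin 2 → k} (ha : a ≠ 0) : Prime (linForm a) := by
  refine Irreducible.prime (irreducible_of_totalDegree_eq_one
    ((isHomogeneous_linForm a).totalDegree (linForm_ne_zero ha)) fun x hx => ?_)
  obtain ⟨i, hi⟩ := Function.ne_iff.1 ha
  have := hx (Finsupp.single i 1)
  rw [coeff_linForm] at this
  exact isUnit_of_dvd_unit this (isUnit_iff_ne_zero.2 hi)

theorem dvd_of_dvd_mul_X_pow {P Q : MvPolynomial (Fin 2) k} {m n : ℕ}
    (h0 : P ∣ Q * X 0 ^ m) (h1 : P ∣ Q * X 1 ^ n) : P ∣ Q := by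
  classical
  let _ := UniqueFactorizationMonoid.toGCDMonoid (MvPolynomial (Fin 2) k)
  have h := (dvd_gcd h0 h1).trans (gcd_mul_left' Q _ _).dvd
  have hc : IsUnit (gcd (X 0 ^ m : MvPolynomial (Fin 2) k) (X 1 ^ n)) := by
    obtain ⟨i, -, hi⟩ := (dvd_prime_pow (X_prime (R := k) (i := (0 : Fin 2))) m).1 (gcd_dvd_left _ (X 1 ^ n))
    refine (hi.isUnit_iff).2 ?_
    rcases Nat.eq_zero_or_pos i with rfl | hi0
    · simp
    exfalso
    have h2 : (X 0 : MvPolynomial (Fin 2) k) ∣ X 1 ^ n :=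
      (dvd_pow_self _ hi0.ne').trans (hi.symm.dvd.trans (gcd_dvd_right _ _))
    have h3 := (X_prime (R := k) (i := (0 : Fin 2))).dvd_of_dvd_pow h2
    rw [X_dvd_X] at h3
    simp at h3
  exact h.trans (hc.mul_right_dvd.2 dvd_rfl)

theorem eq_linForm_pow_of_dvd {P : MvPolynomial (Fin 2) k} {d N : ℕ} (hP : P ≠ 0)
    (hom : P.IsHomogeneous d) {a : Fin 2 → k} (ha : a ≠ 0) (h : P ∣ linForm a ^ N) :
    ∃ c : k, c ≠ 0 ∧ P = C c * linForm a ^ d := by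
  obtain ⟨i, -, u, hu⟩ := (dvd_prime_pow (prime_linForm ha) N).1 h
  obtain ⟨c, hc, hcu⟩ := isUnit_iff_eq_C_of_isReduced.1 (u⁻¹).isUnit
  have hP' : P = C c * linForm a ^ i := by
    rw [← hcu, ← hu, mul_comm, mul_assoc, Units.mul_inv, mul_one]
  have hi : P.IsHomogeneous i := by
    rw [hP']
    simpa using (isHomogeneous_C (Fin 2) c).mul ((isHomogeneous_linForm a).pow i)
  refine ⟨c, hc.ne_zero, ?_⟩
  rw [hom.inj_right hi hP]
  exact hP'

end LinearForm

/-! ### Plane curves parametrised by a polynomial line. -/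

section Curve

variable {k : Type*} [Field k]

/-- Rank-nullity for restriction to the curve: the kernel consists of multiples `F * s` with `s` of
degree at most `N - d`. -/
theorem finrank_restrictTotalDegree_le_map {F : MvPolynomial (Fin 2) k} {d : ℕ}
    (hF0 : F ≠ 0) (hF : F.totalDegree = d) {γ : MvPolynomial (Fin 2) k →ₐ[k] Polynomial k}
    (hker : ∀ p, γ p = 0 → F ∣ p) {N : ℕ} (hN : d ≤ N) :
    Module.finrank k (restrictTotalDegree (Fin 2) k N) ≤
      Module.finrank k ((restrictTotalDegree (Fin 2) k N).map γ.toLinearMap) +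
        Module.finrank k (restrictTotalDegree (Fin 2) k (N - d)) := by
  let W := restrictTotalDegree (Fin 2) k N
  let φ : W →ₗ[k] Polynomial k := γ.toLinearMap.comp W.subtype
  have h1 := φ.finrank_range_add_finrank_ker
  have h2 : LinearMap.range φ = W.map γ.toLinearMap := by
    rw [LinearMap.range_comp, Submodule.range_subtype]
  rw [h2] at h1
  change Module.finrank k W ≤ _
  rw [← h1]
  refine Nat.add_le_add_left ?_ _
  let μ : restrictTotalDegree (Fin 2) k (N - d) →ₗ[k] MvPolynomial (Fin 2) k :=
    (LinearMap.mulLeft k F).comp (Submodule.subtype _)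
  have h3 : (LinearMap.ker φ).map W.subtype ≤ LinearMap.range μ := by
    rintro _ ⟨⟨p, hp⟩, hpk, rfl⟩
    obtain ⟨s, hs⟩ := hker p hpk
    refine ⟨⟨s, ?_⟩, hs.symm⟩
    rw [mem_restrictTotalDegree]
    rcases eq_or_ne s 0 with rfl | hs0
    · simp
    have := (mem_restrictTotalDegree _ _ _).1 hp
    rw [hs, totalDegree_mul_of_isDomain hF0 hs0] at this
    omega
  rw [(Submodule.equivMapOfInjective W.subtype W.injective_subtype (LinearMap.ker φ)).finrank_eq]
  exact (Submodule.finrank_mono h3).trans (LinearMap.finrank_range_le μ)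

theorem map_restrictTotalDegree_le {γ : MvPolynomial (Fin 2) k →ₐ[k] Polynomial k} {n : ℕ}
    (hn : ∀ i, (γ (X i)).natDegree ≤ n) (N : ℕ) :
    (restrictTotalDegree (Fin 2) k N).map γ.toLinearMap ≤ Polynomial.degreeLT k (N * n + 1) := by
  rintro _ ⟨p, hp, rfl⟩
  have h := aeval_natDegree_le p ((mem_restrictTotalDegree _ _ _).1 hp) (fun i => γ (X i)) hn
  rw [show aeval (fun i => γ (X i)) = γ from (aeval_unique γ).symm] at h
  rw [Polynomial.mem_degreeLT]
  exact (Polynomial.degree_le_natDegree).trans_lt (by exact_mod_cast Nat.lt_succ_of_le h)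

theorem finrank_degreeLT (k : Type*) [Field k] (n : ℕ) :
    Module.finrank k (Polynomial.degreeLT k n) = n := by
  rw [(Polynomial.degreeLTEquiv k n).finrank_eq, Module.finrank_fin_fun]

instance (k : Type*) [Field k] (n : ℕ) : Module.Finite k (Polynomial.degreeLT k n) :=
  Module.Finite.equiv (Polynomial.degreeLTEquiv k n).symm

/-- Polynomials of degree at most `N` restrict to a space of dimension at least `dN - d(d-3)/2`,
which lies in the polynomials of degree at most `nN` in one variable. The value `N = d + d²` is
large enough to force `d ≤ n`. -/
theorem totalDegree_le_of_curve {F : MvPolynomial (Fin 2) k}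
    (hF0 : F ≠ 0) {γ : MvPolynomial (Fin 2) k →ₐ[k] Polynomial k}
    (hker : ∀ p, γ p = 0 → F ∣ p) {n : ℕ} (hn : ∀ i, (γ (X i)).natDegree ≤ n) :
    F.totalDegree ≤ n := by
  set d := F.totalDegree with hd
  have h1 := finrank_restrictTotalDegree_le_map hF0 hd.symm hker (N := d + d ^ 2) (by omega)
  have h2 := Submodule.finrank_mono (map_restrictTotalDegree_le hn (d + d ^ 2))
  rw [finrank_degreeLT] at h2
  have h3 := finrank_restrictTotalDegree k (d + d ^ 2)
  have h4 := finrank_restrictTotalDegree k (d + d ^ 2 - d)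
  rw [Nat.add_sub_cancel_left] at h1 h4
  by_contra! hlt
  have h5 : (d + d ^ 2) * n ≤ (d + d ^ 2) * (d - 1) := Nat.mul_le_mul le_rfl (by omega)
  obtain ⟨e, he⟩ : ∃ e, d = e + 1 := ⟨d - 1, by omega⟩
  rw [he] at h1 h2 h3 h4 h5
  simp only [Nat.add_sub_cancel] at h5
  nlinarith

/-- On the curve, polynomials of degree at most `N - 1` have codimension at most `1 + d(d-3)/2`
among one-variable polynomials of degree at most `(N-1)d`. The `d² + 1` products `ℓₐᴺ ℓ_bʲ` restrict
to the latter space, so some nontrivial combination agrees on the curve with a polynomial of degree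
below `N`. Then `F` divides the difference, whose top form is a multiple of a single product. -/
theorem exists_dvd_of_curve {F : MvPolynomial (Fin 2) k}
    (hF0 : F ≠ 0) {γ : MvPolynomial (Fin 2) k →ₐ[k] Polynomial k}
    (hker : ∀ p, γ p = 0 → F ∣ p) (hn : ∀ i, (γ (X i)).natDegree ≤ F.totalDegree)
    {a : Fin 2 → k} (ha : (γ (linForm a)).natDegree < F.totalDegree) (b : Fin 2 → k) :
    ∃ N j, homogeneousComponent F.totalDegree F ∣ linForm a ^ N * linForm b ^ j := by
  classical
  set d := F.totalDegree with hd
  set δ := d ^ 2 with hδ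
  -- Chosen so that `N * (d - 1) + δ * d = (N - 1) * d`.
  set N := d * (δ + 1) with hN
  have hdN : d ≤ N - 1 := by
    have : 0 < d := by omega
    have : d * 1 ≤ d * δ := Nat.mul_le_mul le_rfl (Nat.one_le_pow _ _ this)
    rw [hN, mul_add]; omega
  set V := (restrictTotalDegree (Fin 2) k (N - 1)).map γ.toLinearMap with hV
  let W := Polynomial.degreeLT k ((N - 1) * d + 1)
  have hVW : V ≤ W := map_restrictTotalDegree_le hn (N - 1)
  have : Module.Finite k V := Module.Finite.map _ _
  let E : (Fin (δ + 1) → k) →ₗ[k] MvPolynomial (Fin 2) k :=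
    Fintype.linearCombination k fun j : Fin (δ + 1) => linForm a ^ N * linForm b ^ (j : ℕ)
  have hE : ∀ c, γ (E c) ∈ W := by
    intro c
    rw [Fintype.linearCombination_apply, map_sum]
    refine Submodule.sum_mem _ fun j _ => ?_
    rw [map_smul]
    refine Submodule.smul_mem _ _ ?_
    rw [map_mul, map_pow, map_pow, Polynomial.mem_degreeLT]
    refine Polynomial.degree_le_natDegree.trans_lt ?_
    have h1 : (γ (linForm a) ^ N).natDegree ≤ N * (d - 1) :=
      Polynomial.natDegree_pow_le.trans (Nat.mul_le_mul le_rfl (by omega))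
    have h2 : (γ (linForm b) ^ (j : ℕ)).natDegree ≤ δ * d := by
      refine Polynomial.natDegree_pow_le.trans (Nat.mul_le_mul (by omega) ?_)
      have h3 := aeval_natDegree_le (linForm b)
        (isHomogeneous_linForm b).totalDegree_le (fun i => γ (X i)) hn
      rw [show aeval (fun i => γ (X i)) = γ from (aeval_unique γ).symm] at h3
      omega
    have h4 : N * (d - 1) + δ * d = (N - 1) * d := by
      obtain ⟨e, he⟩ : ∃ e, d = e + 1 := ⟨d - 1, by omega⟩
      rw [Nat.sub_mul, hN, he]
      simp only [Nat.add_sub_cancel]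
      apply Nat.eq_sub_of_add_eq
      ring
    exact_mod_cast Nat.lt_succ_of_le
      (Polynomial.natDegree_mul_le.trans ((Nat.add_le_add h1 h2).trans h4.le))
  let Ψ : (Fin (δ + 1) → k) × V →ₗ[k] W :=
    ((γ.toLinearMap.comp E).codRestrict W hE).coprod (-(Submodule.inclusion hVW))
  have hΨ : LinearMap.ker Ψ ≠ ⊥ := by
    apply LinearMap.ker_ne_bot_of_finrank_lt
    rw [Module.finrank_prod, finrank_degreeLT, Module.finrank_fin_fun]
    have h1 := finrank_restrictTotalDegree_le_map hF0 hd.symm hker hdN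
    have h3 := finrank_restrictTotalDegree k (N - 1)
    have h4 := finrank_restrictTotalDegree k (N - 1 - d)
    obtain ⟨e, he⟩ : ∃ e, N - 1 = e + d := ⟨N - 1 - d, by omega⟩
    rw [he, Nat.add_sub_cancel] at h4
    rw [← hV] at h1
    rw [he] at h3
    rw [he] at h1
    rw [Nat.add_sub_cancel] at h1
    rw [he]
    nlinarith
  obtain ⟨⟨c, v, r, hr, hrv⟩, hx, hx0⟩ := (Submodule.ne_bot_iff _).1 hΨ
  have hΨ0 : γ (E c) - v = 0 := by
    have := congrArg Subtype.val (LinearMap.mem_ker.1 hx)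
    simpa [Ψ, sub_eq_add_neg] using! this
  have hc : c ≠ 0 := by
    rintro rfl
    refine hx0 ?_
    have hv : v = 0 := by simpa using hΨ0
    simp [hv]
  obtain ⟨J, hJ, hJmax⟩ := (Finset.univ.filter fun j => c j ≠ 0).exists_max_image (fun j => (j : ℕ))
    (by obtain ⟨j, hj⟩ := Function.ne_iff.1 hc; exact ⟨j, by simpa using hj⟩)
  simp only [Finset.mem_filter, Finset.mem_univ, true_and] at hJ hJmax
  have hr' : r.totalDegree ≤ N - 1 := (mem_restrictTotalDegree _ _ _).1 hr
  have hN0 : 0 < N := by omega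
  have hom : ∀ j : ℕ, (linForm a ^ N * linForm b ^ j).IsHomogeneous (N + j) := fun j => by
    simpa using ((isHomogeneous_linForm a).pow N).mul ((isHomogeneous_linForm b).pow j)
  have hEdeg : (E c).totalDegree ≤ N + J := by
    rw [Fintype.linearCombination_apply]
    refine totalDegree_finsetSum_le fun j _ => ?_
    by_cases hj : c j = 0
    · simp [hj]
    · exact (totalDegree_smul_le _ _).trans
        ((hom j).totalDegree_le.trans (Nat.add_le_add_left (hJmax j hj) _))
  have hEtop : homogeneousComponent (N + J) (E c) = c J • (linForm a ^ N * linForm b ^ (J : ℕ)) := by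
    rw [Fintype.linearCombination_apply, map_sum, Finset.sum_eq_single J]
    · rw [map_smul, homogeneousComponent_eq_self (hom J)]
    · intro j _ hj
      rw [map_smul, homogeneousComponent_of_mem (hom j), if_neg, smul_zero]
      intro h
      exact hj (Fin.ext (by omega))
    · simp
  have htop : homogeneousComponent (N + J) (E c - r) =
      c J • (linForm a ^ N * linForm b ^ (J : ℕ)) := by
    rw [map_sub, hEtop, homogeneousComponent_eq_zero _ r (by omega), sub_zero]
  obtain ⟨s, hs⟩ := hker (E c - r) (by rw [map_sub, ← hΨ0]; exact congrArg (γ (E c) - ·) hrv)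
  refine ⟨N, J, ?_⟩
  suffices h : homogeneousComponent d F ∣ homogeneousComponent (N + J) (E c - r) by
    rw [htop] at h
    simpa only [inv_smul_smul₀ hJ] using dvd_smul_of_dvd (c J)⁻¹ h
  rcases eq_or_ne s 0 with rfl | hs0
  · simp [hs]
  have hdeg : (E c - r).totalDegree ≤ N + J :=
    (totalDegree_sub _ _).trans (max_le hEdeg (by omega))
  rw [hs, totalDegree_mul_of_isDomain hF0 hs0] at hdeg
  obtain ⟨t, ht⟩ : ∃ t, N + (J : ℕ) = d + t := ⟨N + J - d, by omega⟩
  rw [hs, ht, homogeneousComponent_mul_of_le hd.symm.le (by omega)]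
  exact dvd_mul_right _ _

theorem exists_eq_linForm_pow_of_curve {F : MvPolynomial (Fin 2) k}
    (hF0 : F ≠ 0) (hd : 0 < F.totalDegree) {γ : MvPolynomial (Fin 2) k →ₐ[k] Polynomial k}
    (hker : ∀ p, γ p = 0 → F ∣ p) (hn : ∀ i, (γ (X i)).natDegree ≤ F.totalDegree) :
    ∃ a : Fin 2 → k, a ≠ 0 ∧ ∃ c : k, c ≠ 0 ∧
      homogeneousComponent F.totalDegree F = C c * linForm a ^ F.totalDegree := by
  set d := F.totalDegree
  obtain ⟨a, ha, had⟩ : ∃ a : Fin 2 → k, a ≠ 0 ∧ (γ (linForm a)).natDegree < d := by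
    have key : ∀ a : Fin 2 → k,
        a 0 * (γ (X 0)).coeff d + a 1 * (γ (X 1)).coeff d = 0 → (γ (linForm a)).natDegree < d := by
      intro a h
      have e : γ (linForm a) = Polynomial.C (a 0) * γ (X 0) + Polynomial.C (a 1) * γ (X 1) := by
        simp only [linForm, map_add, map_mul, ← algebraMap_eq, AlgHom.commutes,
          Polynomial.algebraMap_eq]
      have h0 : (γ (linForm a)).coeff d = 0 := by simpa [e] using h
      have h1 : (γ (linForm a)).natDegree ≤ d := by
        rw [e]
        exact Polynomial.natDegree_add_le_of_degree_le
          ((Polynomial.natDegree_C_mul_le _ _).trans (hn 0))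
          ((Polynomial.natDegree_C_mul_le _ _).trans (hn 1))
      refine lt_of_le_of_ne h1 fun h2 => hd.ne ?_
      rw [← h2, Polynomial.coeff_natDegree, Polynomial.leadingCoeff_eq_zero] at h0
      rw [← h2, h0, Polynomial.natDegree_zero]
    by_cases h : (γ (X 0)).coeff d = 0
    · exact ⟨![1, 0], by simp, key _ (by simp [h])⟩
    -- This combination cancels the coefficients of degree `d` of the parametrisation.
    · refine ⟨![(γ (X 1)).coeff d, -(γ (X 0)).coeff d], fun h0 => h ?_, key _ (by simp; ring)⟩
      simpa using congrFun h0 1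
  refine ⟨a, ha, ?_⟩
  -- Taking both coordinates as auxiliary form lets `dvd_of_dvd_mul_X_pow` discard them, which
  -- leaves a power of the prime `linForm a`.
  obtain ⟨N, j, h0⟩ := exists_dvd_of_curve hF0 hker hn had ![1, 0]
  obtain ⟨N', j', h1⟩ := exists_dvd_of_curve hF0 hker hn had ![0, 1]
  refine eq_linForm_pow_of_dvd (homogeneousComponent_totalDegree_ne_zero hF0)
    (homogeneousComponent_isHomogeneous _ _) ha (N := N + N')
    (dvd_of_dvd_mul_X_pow (m := j) (n := j') ?_ ?_)
  · refine h0.trans ?_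
    simp only [linForm, pow_add]
    exact mul_dvd_mul (dvd_mul_right _ _) (by simp)
  · refine h1.trans ?_
    simp only [linForm, pow_add]
    exact mul_dvd_mul (dvd_mul_left _ _) (by simp)

end Curve

/-! ### Degrees and top parts of plane automorphisms. -/

namespace PolyEnd

section Degree

theorem totalDegree_comp_le {n : ℕ} {R : Type u} [CommRing R] (f : PolyEnd n R) (i : Fin n) :
    (f.comp i).totalDegree ≤ f.deg :=
  Finset.le_sup (f := fun i => (f.comp i).totalDegree) (Finset.mem_univ i)

theorem deg_le_iff {n : ℕ} {R : Type u} [CommRing R] {f : PolyEnd n R} {d : ℕ} :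
    f.deg ≤ d ↔ ∀ i, (f.comp i).totalDegree ≤ d := by
  simp [deg]

theorem deg_mul_le {n : ℕ} {R : Type u} [CommRing R] (f g : PolyEnd n R) :
    (f * g).deg ≤ f.deg * g.deg :=
  deg_le_iff.2 fun i => totalDegree_bind₁_le g.totalDegree_comp_le (f.totalDegree_comp_le i)

theorem comp_ext_of_mul_eq_one {n : ℕ} {R : Type u} [CommRing R] {f g : PolyEnd n R}
    (h : f * g = 1) (i : Fin n) : bind₁ g.comp (f.comp i) = X i := by
  rw [← mul_comp, h, one_comp]

theorem exists_totalDegree_eq_deg {n : ℕ} [NeZero n] {R : Type u} [CommRing R] (f : PolyEnd n R) :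
    ∃ i, (f.comp i).totalDegree = f.deg := by
  obtain ⟨i, -, hi⟩ := Finset.exists_mem_eq_sup Finset.univ Finset.univ_nonempty
    fun i => (f.comp i).totalDegree
  exact ⟨i, hi.symm⟩

variable {k : Type u} [Field k] {f g : PolyEnd 2 k}

theorem comp_ne_zero (hfg : f * g = 1) (i : Fin 2) : f.comp i ≠ 0 := by
  intro h
  have := comp_ext_of_mul_eq_one hfg i
  rw [h, map_zero] at this
  exact X_ne_zero i this.symm

/-- The parametrisation of the curve `fᵢ = 0` by the polynomial map `g`, when `g = f⁻¹`. -/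
def curveParam (g : PolyEnd 2 k) (i : Fin 2) : MvPolynomial (Fin 2) k →ₐ[k] Polynomial k :=
  (aeval fun m => if m = i then 0 else Polynomial.X).comp (bind₁ g.comp)

theorem X_dvd_of_aeval_eq_zero {i : Fin 2} {p : MvPolynomial (Fin 2) k}
    (h : aeval (fun m => if m = i then 0 else (Polynomial.X : Polynomial k)) p = 0) : X i ∣ p := by
  obtain ⟨j, hj⟩ : ∃ j : Fin 2, ∀ m, m ≠ i → m = j := by
    fin_cases i
    · exact ⟨1, by decide⟩
    · exact ⟨0, by decide⟩
  rw [← Ideal.mem_span_singleton, ← Ideal.Quotient.eq_zero_iff_mem]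
  let ι : Polynomial k →ₐ[k] MvPolynomial (Fin 2) k ⧸ Ideal.span {(X i : MvPolynomial (Fin 2) k)} :=
    Polynomial.aeval (Ideal.Quotient.mk _ (X j))
  have e : Ideal.Quotient.mkₐ k (Ideal.span {(X i : MvPolynomial (Fin 2) k)}) =
      ι.comp (aeval fun m => if m = i then 0 else (Polynomial.X : Polynomial k)) := by
    refine MvPolynomial.algHom_ext fun m => ?_
    by_cases hm : m = i
    · subst hm
      simp only [AlgHom.comp_apply, aeval_X, if_pos, map_zero]
      exact Ideal.Quotient.eq_zero_iff_mem.2 (Ideal.mem_span_singleton_self _)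
    · obtain rfl := hj m hm
      simp [ι, hm]
  have := congrArg (fun φ => φ p) e
  simpa [h] using this

/-- If `p ∘ g` vanishes on the line `xᵢ = 0` it is divisible by `xᵢ`; composing with `f` turns this
into divisibility of `p` by `fᵢ`. -/
theorem dvd_of_curveParam_eq_zero (hgf : g * f = 1) (i : Fin 2)
    (p : MvPolynomial (Fin 2) k) (hp : curveParam g i p = 0) : f.comp i ∣ p := by
  obtain ⟨q, hq⟩ : X i ∣ bind₁ g.comp p := X_dvd_of_aeval_eq_zero hp
  have h := congrArg (bind₁ f.comp) hq
  rw [bind₁_bind₁, show (fun i => bind₁ f.comp (g.comp i)) = X from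
    funext (comp_ext_of_mul_eq_one hgf), ← aeval_eq_bind₁, aeval_X_left_apply, map_mul,
    bind₁_X_right] at h
  exact ⟨_, h⟩

theorem natDegree_curveParam_le (g : PolyEnd 2 k) (i j : Fin 2) :
    (curveParam g i (X j)).natDegree ≤ g.deg := by
  have := aeval_natDegree_le (g.comp j) (g.totalDegree_comp_le j)
    (fun m => if m = i then 0 else (Polynomial.X : Polynomial k)) (n := 1)
    (fun m => by split_ifs <;> simp)
  simpa [curveParam] using this

theorem deg_le_of_mul_eq_one (hfg : f * g = 1) (hgf : g * f = 1) : f.deg ≤ g.deg := by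
  obtain ⟨i, hi⟩ := f.exists_totalDegree_eq_deg
  rw [← hi]
  exact totalDegree_le_of_curve (comp_ne_zero hfg i) (dvd_of_curveParam_eq_zero hgf i)
    (natDegree_curveParam_le g i)

/-- The degree of the inverse of a plane automorphism is the degree of the automorphism. -/
theorem deg_eq_of_mul_eq_one (hfg : f * g = 1) (hgf : g * f = 1) : f.deg = g.deg :=
  (deg_le_of_mul_eq_one hfg hgf).antisymm (deg_le_of_mul_eq_one hgf hfg)

theorem one_le_deg (hfg : f * g = 1) : 1 ≤ f.deg := by
  by_contra! h
  have h1 := deg_mul_le f g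
  rw [Nat.lt_one_iff.1 h, zero_mul, hfg] at h1
  have := ((1 : PolyEnd 2 k).totalDegree_comp_le 0).trans h1
  rw [one_comp, totalDegree_X] at this
  omega

/-- The homogeneous part of degree `deg f` of the `i`-th component. -/
def top (f : PolyEnd 2 k) (i : Fin 2) : MvPolynomial (Fin 2) k :=
  homogeneousComponent f.deg (f.comp i)

theorem exists_top_eq_linForm_pow (hfg : f * g = 1) (hgf : g * f = 1) :
    ∃ i, ∃ a : Fin 2 → k, a ≠ 0 ∧ ∃ c : k, c ≠ 0 ∧ f.top i = C c * linForm a ^ f.deg := by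
  obtain ⟨i, hi⟩ := f.exists_totalDegree_eq_deg
  have := exists_eq_linForm_pow_of_curve (comp_ne_zero hfg i) (hi ▸ one_le_deg hfg)
    (dvd_of_curveParam_eq_zero hgf i)
    (fun j => (natDegree_curveParam_le g i j).trans
      (hi.trans (deg_eq_of_mul_eq_one hfg hgf)).ge)
  rw [hi] at this
  exact ⟨i, this⟩

theorem top_ne_zero {i : Fin 2} (hf : f.comp i ≠ 0) (hi : (f.comp i).totalDegree = f.deg) :
    f.top i ≠ 0 := by
  unfold top
  rw [← hi]
  exact homogeneousComponent_totalDegree_ne_zero hf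

theorem homogeneousComponent_mul_comp (h f : PolyEnd 2 k) (hf : 0 < f.deg) (i : Fin 2) :
    homogeneousComponent (h.deg * f.deg) ((h * f).comp i) = bind₁ f.top (h.top i) :=
  homogeneousComponent_bind₁ hf f.totalDegree_comp_le (h.totalDegree_comp_le i)

/-- The identity has degree `1`, less than `deg g * deg f`. -/
theorem bind₁_top_top_eq_zero (hfg : f * g = 1) (hgf : g * f = 1) (hd : 2 ≤ f.deg) (i : Fin 2) :
    bind₁ f.top (g.top i) = 0 := by
  rw [← homogeneousComponent_mul_comp g f (by omega), hgf, one_comp]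
  refine homogeneousComponent_eq_zero _ _ ?_
  rw [totalDegree_X, ← deg_eq_of_mul_eq_one hfg hgf]
  nlinarith

end Degree

section Proportional

variable {k : Type u} [Field k]

theorem aeval_mul_of_isHomogeneous {σ A : Type*} [CommRing A] [Algebra k A]
    {G : MvPolynomial σ k} {e : ℕ} (hG : G.IsHomogeneous e) (c : A) (v : σ → A) :
    aeval (fun i => c * v i) G = c ^ e * aeval v G := by
  rw [aeval_def, aeval_def, eval₂_eq, eval₂_eq, Finset.mul_sum]
  refine Finset.sum_congr rfl fun s hs => ?_
  have : s.degree = e := by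
    rw [Finsupp.degree_eq_weight_one]
    exact hG (mem_support_iff.1 hs)
  simp only [mul_pow, Finset.prod_mul_distrib]
  rw [Finset.prod_pow_eq_pow_sum, show ∑ i ∈ s.support, s i = e from this]
  ring

/-- The quotient `v j / v i` is a root of the dehomogenisation of `G`, so it is algebraic over `k`
and therefore a constant. -/
theorem exists_eq_C_mul_of_aeval_eq_zero [IsAlgClosed k] {G : MvPolynomial (Fin 2) k} {e : ℕ}
    (hG : G.IsHomogeneous e) (hG0 : G ≠ 0) {v : Fin 2 → MvPolynomial (Fin 2) k}
    (hv : aeval v G = 0) {i : Fin 2} (hi : v i ≠ 0) (j : Fin 2) : ∃ c : k, v j = C c * v i := by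
  rcases eq_or_ne j i with rfl | hji
  · exact ⟨1, by simp⟩
  have hm : ∀ m, m ≠ i → m = j := by
    clear hv hi
    omega
  let K := FractionRing (MvPolynomial (Fin 2) k)
  set ι := algebraMap (MvPolynomial (Fin 2) k) K with hι
  have hι0 : ι (v i) ≠ 0 := by
    rwa [Ne, FaithfulSMul.algebraMap_eq_zero_iff]
  set r : K := ι (v j) / ι (v i)
  let p : Polynomial k := aeval (fun m => if m = i then 1 else Polynomial.X) G
  have hpr : Polynomial.aeval r p = 0 := by
    have h1 : aeval (fun m => ι (v m)) G = 0 := by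
      have := congrArg ι hv
      rw [map_zero] at this
      rw [← this]
      exact (MvPolynomial.aeval_algebraMap_apply K v G)
    have h2 : (fun m => ι (v m)) = fun m => ι (v i) * (if m = i then 1 else r) := by
      funext m
      split_ifs with h
      · rw [h, mul_one]
      · rw [hm m h, mul_div_cancel₀ _ hι0]
    rw [h2, aeval_mul_of_isHomogeneous hG] at h1
    have h3 := (mul_eq_zero.1 h1).resolve_left (pow_ne_zero _ hι0)
    rw [← h3]
    change (Polynomial.aeval r).comp (aeval fun m => if m = i then 1 else Polynomial.X) G = _
    congr 1
    refine MvPolynomial.algHom_ext fun m => ?_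
    by_cases h : m = i <;> simp [h]
  -- If the dehomogenisation vanished, `G` would vanish wherever `xᵢ ≠ 0`, so `X i * G` would be
  -- zero.
  have hp0 : p ≠ 0 := by
    intro hp
    refine hG0 ?_
    have h1 : X i * G = 0 := by
      refine MvPolynomial.funext fun w => ?_
      rw [map_mul, eval_X, map_zero]
      rcases eq_or_ne (w i) 0 with hw | hw
      · rw [hw, zero_mul]
      have h2 : w = fun m => w i * (if m = i then 1 else w j / w i) := by
        funext m
        split_ifs with h
        · rw [h, mul_one]
        · rw [hm m h, mul_div_cancel₀ _ hw]
      have h3 : aeval (fun m => if m = i then 1 else w j / w i) G = (0 : k) := by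
        have := congrArg (Polynomial.aeval (w j / w i)) hp
        rw [map_zero] at this
        rw [← this]
        change _ = (Polynomial.aeval (w j / w i)).comp
          (aeval fun m => if m = i then 1 else Polynomial.X) G
        congr 1
        refine MvPolynomial.algHom_ext fun m => ?_
        by_cases h : m = i <;> simp [h]
      have h4 := aeval_mul_of_isHomogeneous hG (w i) (fun m => if m = i then 1 else w j / w i)
      rw [h3, mul_zero, ← h2] at h4
      rw [← aeval_eq_eval, h4, mul_zero]
    exact (mul_eq_zero.1 h1).resolve_left (X_ne_zero i)
  have hint : IsIntegral k r := IsAlgebraic.isIntegral ⟨p, hp0, hpr⟩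
  obtain ⟨c, hc⟩ := minpoly.mem_range_of_degree_eq_one k r
    (IsAlgClosed.degree_eq_one_of_irreducible k (minpoly.irreducible hint))
  refine ⟨c, ?_⟩
  apply FaithfulSMul.algebraMap_injective (MvPolynomial (Fin 2) k) K
  rw [map_mul]
  rw [IsScalarTower.algebraMap_apply k (MvPolynomial (Fin 2) k) K] at hc
  change ι (v j) = ι (algebraMap _ _ c) * ι (v i)
  rw [hc, div_mul_cancel₀ _ hι0]

end Proportional

section Top

variable {k : Type u} [Field k]

/-- The components of highest degree of `f` are `aᵢ ℓᵈ` for a linear form `ℓ`. The zero of `ℓ` is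
the indeterminacy point of `f` at infinity and `a` is the point to which `f` contracts the line
at infinity. -/
structure IsTop (f : PolyEnd 2 k) (l a : Fin 2 → k) : Prop where
  form_ne_zero : l ≠ 0
  vec_ne_zero : a ≠ 0
  top_eq : ∀ i, f.top i = C (a i) * linForm l ^ f.deg

theorem exists_isTop [IsAlgClosed k] {f g : PolyEnd 2 k} (hfg : f * g = 1) (hgf : g * f = 1)
    (hd : 2 ≤ f.deg) : ∃ l a, f.IsTop l a := by
  obtain ⟨i, l, hl, c, hc, hi⟩ := exists_top_eq_linForm_pow hfg hgf
  obtain ⟨m, hm⟩ := g.exists_totalDegree_eq_deg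
  have hi0 : f.top i ≠ 0 := by
    rw [hi]
    exact mul_ne_zero (by simpa using hc) (pow_ne_zero _ (linForm_ne_zero hl))
  have h := exists_eq_C_mul_of_aeval_eq_zero (homogeneousComponent_isHomogeneous _ _)
    (top_ne_zero (comp_ne_zero hgf m) hm) (bind₁_top_top_eq_zero hfg hgf hd m) hi0
  choose b hb using h
  refine ⟨l, fun j => b j * c, hl, fun h0 => hi0 ?_, fun j => ?_⟩
  · rw [hb i, hi, ← mul_assoc, ← C_mul, show b i * c = 0 from congrFun h0 i, C_0, zero_mul]
  · rw [hb j, hi, ← mul_assoc, ← C_mul]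

theorem bind₁_linForm (l a : Fin 2 → k) (L : MvPolynomial (Fin 2) k) :
    bind₁ (fun i => C (a i) * L) (linForm l) = C (eval a (linForm l)) * L := by
  simp [linForm]
  ring

theorem IsTop.bind₁_top {f h : PolyEnd 2 k} {l a l' a' : Fin 2 → k} (hf : f.IsTop l a)
    (hh : h.IsTop l' a') (i : Fin 2) : bind₁ f.top (h.top i) =
      C (a' i) * (C (eval a (linForm l')) * linForm l ^ f.deg) ^ h.deg := by
  rw [hh.top_eq, map_mul, map_pow, show f.top = _ from funext hf.top_eq, bind₁_linForm, bind₁_C_right]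

theorem IsTop.exists_vec_ne_zero {f : PolyEnd 2 k} {l a : Fin 2 → k} (hf : f.IsTop l a) :
    ∃ i, a i ≠ 0 := Function.ne_iff.1 hf.vec_ne_zero

/-- The point to which `f` contracts infinity is the indeterminacy point of `f⁻¹`. -/
theorem IsTop.eval_eq_zero {f g : PolyEnd 2 k} {l a l' a' : Fin 2 → k} (hf : f.IsTop l a)
    (hg : g.IsTop l' a') (hfg : f * g = 1) (hgf : g * f = 1) (hd : 2 ≤ f.deg) :
    eval a (linForm l') = 0 := by
  obtain ⟨i, hi⟩ := hg.exists_vec_ne_zero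
  have h := bind₁_top_top_eq_zero hfg hgf hd i
  rw [hf.bind₁_top hg] at h
  have h1 := (mul_eq_zero.1 h).resolve_left (by simpa using hi)
  by_contra h2
  exact pow_ne_zero _ (mul_ne_zero (by simpa using h2)
    (pow_ne_zero _ (linForm_ne_zero hf.form_ne_zero))) h1

/-- The expected top part of `h * f` carries the factor `ℓ'(a)` to the power `deg h`, so it survives
unless `a` is the indeterminacy point of `h`. -/
theorem IsTop.deg_mul {f h : PolyEnd 2 k} {l a l' a' : Fin 2 → k} (hf : f.IsTop l a)
    (hh : h.IsTop l' a') (hd : 0 < f.deg) (hne : eval a (linForm l') ≠ 0) :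
    (h * f).deg = h.deg * f.deg := by
  refine (deg_mul_le h f).antisymm ?_
  obtain ⟨i, hi⟩ := hh.exists_vec_ne_zero
  by_contra! hlt
  have h1 := homogeneousComponent_eq_zero _ _ ((totalDegree_comp_le (h * f) i).trans_lt hlt)
  rw [homogeneousComponent_mul_comp h f hd, hf.bind₁_top hh] at h1
  refine mul_ne_zero (by simpa using hi) (pow_ne_zero _ (mul_ne_zero (by simpa using hne)
    (pow_ne_zero _ (linForm_ne_zero hf.form_ne_zero)))) h1

/-- A nonzero linear form in two variables has a single zero up to scaling. -/
theorem eval_linForm_eq_zero_of_common {l a b m : Fin 2 → k} (hl : l ≠ 0) (ha : a ≠ 0)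
    (hla : eval a (linForm l) = 0) (hlb : eval b (linForm l) = 0) (hma : eval a (linForm m) = 0) :
    eval b (linForm m) = 0 := by
  rw [eval_linForm] at *
  have hdet : a 0 * b 1 = a 1 * b 0 := by
    obtain ⟨i, hi⟩ := Function.ne_iff.1 hl
    fin_cases i
    · refine mul_left_cancel₀ (show l 0 ≠ 0 from hi) ?_
      linear_combination b 1 * hla - a 1 * hlb
    · refine mul_left_cancel₀ (show l 1 ≠ 0 from hi) ?_
      linear_combination -b 0 * hla + a 0 * hlb
  obtain ⟨i, hi⟩ := Function.ne_iff.1 ha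
  fin_cases i
  · refine mul_left_cancel₀ (show a 0 ≠ 0 from hi) ?_
    linear_combination b 0 * hma + m 1 * hdet
  · refine mul_left_cancel₀ (show a 1 ≠ 0 from hi) ?_
    linear_combination b 1 * hma - m 0 * hdet

end Top

end PolyEnd

/-! ### Indeterminacy points at infinity. -/

section Regular

variable {k : Type u} [Field k]

theorem aeval_cons_zero_homogenize {n d : ℕ} {A : Type*} [CommRing A] [Algebra k A]
    (p : MvPolynomial (Fin n) k) (w : Fin (n + 1) → A) (hw : w 0 = 0) :
    aeval w (homogenize d p) = aeval (fun i => w i.succ) (homogeneousComponent d p) := by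
  unfold homogenize
  rw [map_sum, Finset.sum_eq_single d]
  · simp [aeval_rename, Function.comp_def]
  · intro j hj hjd
    have : d - j ≠ 0 := by
      have := Finset.mem_range.1 hj
      omega
    simp [hw, this]
  · simp

theorem PolyEnd.IsTop.mk_mem_indeterminacyLocus {f : PolyEnd 2 k} {l a v : Fin 2 → k}
    (hf : f.IsTop l a) (hd : 0 < f.deg) (hv : eval v (linForm l) = 0)
    (hw : (Fin.cons 0 v : Fin 3 → k) ≠ 0) :
    Projectivization.mk k (Fin.cons 0 v : Fin 3 → k) hw ∈ indeterminacyLocus f.projExtension := by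
  rintro ⟨e, q, -, hq, j, hj⟩
  refine hj ?_
  obtain ⟨i, hi⟩ := hf.exists_vec_ne_zero
  set h := f.projExtension
  have h0 : h 0 = X 0 ^ f.deg := rfl
  have hs : ∀ m : Fin 2, h m.succ = homogenize f.deg (f.comp m) := fun m => rfl
  have hX : ¬ (X 0 : MvPolynomial (Fin 3) k) ∣ h i.succ := by
    rintro ⟨s, hs'⟩
    have h1 := aeval_cons_zero_homogenize (d := f.deg) (f.comp i)
      (Fin.cons 0 X : Fin 3 → MvPolynomial (Fin 2) k) rfl
    rw [← hs, hs', map_mul, aeval_X, Fin.cons_zero, zero_mul] at h1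
    simp only [Fin.cons_succ, aeval_X_left_apply] at h1
    refine mul_ne_zero (by simpa using hi) (pow_ne_zero _ (linForm_ne_zero hf.form_ne_zero))
      ((hf.top_eq i).symm.trans h1.symm)
  -- The entries `X 0 ^ f.deg` and `h i.succ` are coprime, so any other representation `q` of the
  -- map is a polynomial multiple of `h` and vanishes wherever `h` does.
  obtain ⟨r, hr⟩ : X 0 ^ f.deg ∣ q 0 := by
    refine X_prime.pow_dvd_of_dvd_mul_right _ hX ?_
    rw [hq 0 i.succ, h0]
    exact dvd_mul_left _ _
  have hqj : q j = r * h j := by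
    have h1 := hq j 0
    rw [h0, hr] at h1
    refine mul_right_cancel₀ (pow_ne_zero f.deg (X_ne_zero (R := k) (0 : Fin 3))) ?_
    rw [h1]
    ring
  obtain ⟨c, hc⟩ := Projectivization.exists_smul_eq_mk_rep k (Fin.cons 0 v : Fin 3 → k) hw
  set w := (Projectivization.mk k (Fin.cons 0 v : Fin 3 → k) hw).rep
  have hw0 : w 0 = 0 := by rw [← hc]; simp
  have hws : (fun m : Fin 2 => w m.succ) = fun m => (c : k) * v m := by
    funext m
    rw [← hc]
    simp [Units.smul_def]
  rw [hqj, map_mul]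
  refine mul_eq_zero_of_right _ ?_
  refine Fin.cases ?_ (fun m => ?_) j
  · simp [h0, hw0, hd.ne']
  · rw [hs, ← aeval_eq_eval, aeval_cons_zero_homogenize _ _ hw0, hws, aeval_eq_eval]
    have h2 : eval (fun m => (c : k) * v m) (f.top m) = 0 := by
      rw [eval_linForm] at hv
      rw [hf.top_eq, map_mul, map_pow, eval_linForm]
      refine mul_eq_zero_of_right _ ?_
      rw [pow_eq_zero_iff hd.ne']
      linear_combination (c : k) * hv
    exact h2

theorem PolyEnd.eval_linForm_ne_zero_of_regular {f : PolyAut 2 k} (hf : DynamicallyRegular f)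
    {l a l' a' v : Fin 2 → k} (h : (f : PolyEnd 2 k).IsTop l a)
    (h' : (↑f⁻¹ : PolyEnd 2 k).IsTop l' a') (hv : v ≠ 0) (hl : eval v (linForm l) = 0) :
    eval v (linForm l') ≠ 0 := by
  intro hl'
  have hw : (Fin.cons 0 v : Fin 3 → k) ≠ 0 := fun h0 =>
    hv (funext fun i => by simpa using congrFun h0 i.succ)
  exact Set.disjoint_left.1 hf.2
    (h.mk_mem_indeterminacyLocus (PolyEnd.one_le_deg f.mul_inv) hl hw)
    (h'.mk_mem_indeterminacyLocus (PolyEnd.one_le_deg f.inv_mul) hl' hw)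

end Regular

/-! ### Conjugators of minimal degree. -/

section Degree

variable {k : Type u} [Field k]

theorem PolyAut.deg_inv (f : PolyAut 2 k) : (↑f⁻¹ : PolyEnd 2 k).deg = (f : PolyEnd 2 k).deg :=
  PolyEnd.deg_eq_of_mul_eq_one f.inv_mul f.mul_inv

theorem PolyAut.exists_isTop [IsAlgClosed k] (f : PolyAut 2 k) (hd : 2 ≤ (f : PolyEnd 2 k).deg) :
    ∃ l a, (f : PolyEnd 2 k).IsTop l a :=
  PolyEnd.exists_isTop f.mul_inv f.inv_mul hd

/-- If composing with `f` does not lower the degree of `h`, then either `h * f * h⁻¹` has large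
degree or `f⁻¹` and `h⁻¹` contract the line at infinity to the same point. -/
theorem PolyAut.deg_sq_le_or_exists [IsAlgClosed k] {f h : PolyAut 2 k}
    (hf : 2 ≤ (f : PolyEnd 2 k).deg) (hh : 2 ≤ (h : PolyEnd 2 k).deg)
    (hmin : (h : PolyEnd 2 k).deg ≤ (↑(h * f) : PolyEnd 2 k).deg) {l a l' a' : Fin 2 → k}
    (hfi : (↑f⁻¹ : PolyEnd 2 k).IsTop l a) (hhi : (↑h⁻¹ : PolyEnd 2 k).IsTop l' a') :
    (h : PolyEnd 2 k).deg ^ 2 ≤ (↑(h * f * h⁻¹) : PolyEnd 2 k).deg ∨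
      ∃ m : Fin 2 → k, m ≠ 0 ∧ eval a (linForm m) = 0 ∧ eval a' (linForm m) = 0 := by
  obtain ⟨m, b, hu⟩ := PolyAut.exists_isTop (h * f) (hh.trans hmin)
  -- Otherwise `deg h = deg (h * f) * deg f⁻¹`, which is at least `2 * deg h`.
  have h1 : eval a (linForm m) = 0 := by
    by_contra hne
    have h2 := hfi.deg_mul hu (by rw [deg_inv]; omega) hne
    rw [← Units.val_mul, mul_inv_cancel_right, deg_inv] at h2
    nlinarith
  by_cases h3 : eval a' (linForm m) = 0
  · exact Or.inr ⟨m, hu.form_ne_zero, h1, h3⟩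
  · left
    have h2 := hhi.deg_mul hu (by rw [deg_inv]; omega) h3
    rw [← Units.val_mul, deg_inv] at h2
    rw [h2, sq]
    exact Nat.mul_le_mul hmin le_rfl

theorem PolyAut.deg_sq_le_of_regular [IsAlgClosed k] {f h : PolyAut 2 k}
    (hf : DynamicallyRegular f)
    (hmin : (h : PolyEnd 2 k).deg ≤ (↑(h * f) : PolyEnd 2 k).deg)
    (hmin' : (h : PolyEnd 2 k).deg ≤ (↑(h * f⁻¹) : PolyEnd 2 k).deg) :
    (h : PolyEnd 2 k).deg ^ 2 ≤ (↑(h * f * h⁻¹) : PolyEnd 2 k).deg := by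
  -- In degree `1` the top part need not have the form `IsTop`, but then the bound is trivial.
  rcases lt_or_ge (h : PolyEnd 2 k).deg 2 with hh | hh
  · have h1 := PolyEnd.one_le_deg (h * f * h⁻¹).mul_inv
    have h2 := PolyEnd.one_le_deg h.mul_inv
    rw [show (h : PolyEnd 2 k).deg = 1 by omega]
    simpa using h1
  obtain ⟨l, a, hF⟩ := PolyAut.exists_isTop f hf.1
  obtain ⟨l', a', hFi⟩ := PolyAut.exists_isTop f⁻¹ (by rw [deg_inv]; exact hf.1)
  obtain ⟨m, b, hHi⟩ := PolyAut.exists_isTop h⁻¹ (by rw [deg_inv]; exact hh)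
  rcases deg_sq_le_or_exists hf.1 hh hmin hFi hHi with h1 | ⟨p, hp, hpa', hpb⟩
  · exact h1
  rcases deg_sq_le_or_exists (f := f⁻¹) (by rw [deg_inv]; exact hf.1) hh hmin'
    (by rwa [inv_inv]) hHi with h1 | ⟨q, hq, hqa, hqb⟩
  · rwa [show h * f⁻¹ * h⁻¹ = (h * f * h⁻¹)⁻¹ by group, deg_inv] at h1
  have hla' := hFi.eval_eq_zero hF f.inv_mul f.mul_inv (by rw [deg_inv]; exact hf.1)
  have hl'a := hF.eval_eq_zero hFi f.mul_inv f.inv_mul hf.1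
  -- The point `b` coincides with both `a` and `a'`, so it is a common zero of `l'` and `l`.
  exact absurd (PolyEnd.eval_linForm_eq_zero_of_common hq hF.vec_ne_zero hqa hqb hl'a)
    (PolyEnd.eval_linForm_ne_zero_of_regular hf hF hFi hHi.vec_ne_zero
      (PolyEnd.eval_linForm_eq_zero_of_common hp hFi.vec_ne_zero hpa' hpb hla'))

theorem exists_conj_deg_sq_le [IsAlgClosed k] (f : SAut 2 k)
    (hf : DynamicallyRegular (f : PolyAut 2 k)) (g : SAut 2 k) (hg : IsConj f g) :
    ∃ h : SAut 2 k, g = h * f * h⁻¹ ∧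
      ((h : PolyAut 2 k) : PolyEnd 2 k).deg ^ 2 ≤ ((g : PolyAut 2 k) : PolyEnd 2 k).deg := by
  obtain ⟨c, hc⟩ := isConj_iff.1 hg
  obtain ⟨h, hh, hmin⟩ := exists_minimalFor_of_wellFoundedLT
    (fun h : SAut 2 k => g = h * f * h⁻¹)
    (fun h : SAut 2 k => ((h : PolyAut 2 k) : PolyEnd 2 k).deg) ⟨c, hc.symm⟩
  have key : ∀ u : SAut 2 k, g = u * f * u⁻¹ →
      ((h : PolyAut 2 k) : PolyEnd 2 k).deg ≤ ((u : PolyAut 2 k) : PolyEnd 2 k).deg := fun u hu =>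
    (le_total _ _).elim id (hmin hu)
  refine ⟨h, hh, ?_⟩
  rw [hh]
  -- Both `h * f` and `h * f⁻¹` again conjugate `f` to `g`, because `f` commutes with its powers.
  exact PolyAut.deg_sq_le_of_regular hf (key (h * f) (by rw [hh]; group))
    (key (h * f⁻¹) (by rw [hh]; group))

end Degree

/-! ### Lowest homogeneous parts under substitution. -/

section Order

variable {σ τ R : Type*} [CommRing R]

/-- All monomials of `p` have degree at least `m`. -/
def OrderGE (m : ℕ) (p : MvPolynomial σ R) : Prop := ∀ s : σ →₀ ℕ, s.degree < m → coeff s p = 0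

theorem OrderGE.homogeneousComponent_eq_zero {m n : ℕ} {p : MvPolynomial σ R} (h : OrderGE m p)
    (hn : n < m) : homogeneousComponent n p = 0 := by
  classical
  ext s
  rw [coeff_homogeneousComponent, coeff_zero]
  split_ifs with hs
  · exact h s (hs ▸ hn)
  · rfl

theorem OrderGE.mul {p q : MvPolynomial σ R} {m n : ℕ} (hp : OrderGE m p) (hq : OrderGE n q) :
    OrderGE (m + n) (p * q) ∧ homogeneousComponent (m + n) (p * q) =
      homogeneousComponent m p * homogeneousComponent n q := by
  classical
  constructor
  · intro s hs
    rw [coeff_mul]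
    refine Finset.sum_eq_zero fun x hx => ?_
    rw [Finset.HasAntidiagonal.mem_antidiagonal] at hx
    have hd : x.1.degree + x.2.degree = s.degree := by rw [← map_add, hx]
    by_cases h1 : x.1.degree < m
    · rw [hp _ h1, zero_mul]
    · rw [hq _ (by omega), mul_zero]
  · ext s
    rw [coeff_homogeneousComponent]
    split_ifs with hs
    · rw [coeff_mul, coeff_mul]
      refine Finset.sum_congr rfl fun x hx => ?_
      rw [Finset.HasAntidiagonal.mem_antidiagonal] at hx
      have hd : x.1.degree + x.2.degree = m + n := by rw [← map_add, hx, hs]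
      rw [coeff_homogeneousComponent, coeff_homogeneousComponent]
      by_cases h1 : x.1.degree = m
      · rw [if_pos h1, if_pos (by omega)]
      · rw [if_neg h1, zero_mul]
        rcases lt_or_gt_of_ne h1 with h | h
        · rw [hp _ h, zero_mul]
        · rw [hq _ (by omega), mul_zero]
    · symm
      by_contra h
      refine hs ?_
      rw [Finsupp.degree_eq_weight_one]
      exact ((homogeneousComponent_isHomogeneous m p).mul
        (homogeneousComponent_isHomogeneous n q)) h

theorem OrderGE.pow {p : MvPolynomial σ R} (hp : OrderGE 1 p) (j : ℕ) :
    OrderGE j (p ^ j) ∧ homogeneousComponent j (p ^ j) = homogeneousComponent 1 p ^ j := by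
  induction j with
  | zero => exact ⟨fun s hs => absurd hs (Nat.not_lt_zero _), by simp⟩
  | succ j ih =>
    rw [pow_succ, pow_succ, ← ih.2]
    exact ih.1.mul hp

theorem OrderGE.prod_pow {w : σ → MvPolynomial τ R} (hw : ∀ i, OrderGE 1 (w i))
    (s : Finset σ) (e : σ → ℕ) :
    OrderGE (∑ i ∈ s, e i) (∏ i ∈ s, w i ^ e i) ∧
      homogeneousComponent (∑ i ∈ s, e i) (∏ i ∈ s, w i ^ e i) =
        ∏ i ∈ s, homogeneousComponent 1 (w i) ^ e i := by
  classical
  induction s using Finset.induction_on with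
  | empty => exact ⟨fun s hs => absurd hs (Nat.not_lt_zero _), by simp⟩
  | insert a s ha ih =>
    rw [Finset.sum_insert ha, Finset.prod_insert ha, Finset.prod_insert ha, ← ih.2,
      ← ((hw a).pow (e a)).2]
    exact ((hw a).pow (e a)).1.mul ih.1

theorem OrderGE.homogeneousComponent_bind₁ {w : σ → MvPolynomial τ R} (hw : ∀ i, OrderGE 1 (w i))
    {m : ℕ} {p : MvPolynomial σ R} (hp : OrderGE m p) :
    homogeneousComponent m (bind₁ w p) =
      bind₁ (fun i => homogeneousComponent 1 (w i)) (homogeneousComponent m p) := by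
  conv_lhs => rw [p.as_sum]
  conv_rhs => rw [p.as_sum]
  simp only [map_sum]
  refine Finset.sum_congr rfl fun s hs => ?_
  have h1 := OrderGE.prod_pow hw s.support s
  rcases lt_trichotomy s.degree m with h | h | h
  · exact absurd (hp s h) (mem_support_iff.1 hs)
  · have : homogeneousComponent m (monomial s (coeff s p)) = monomial s (coeff s p) :=
      homogeneousComponent_eq_self (isHomogeneous_monomial _ h)
    rw [this, bind₁_monomial, bind₁_monomial, homogeneousComponent_C_mul]
    congr 1
    rw [← h1.2, ← h]
    rfl
  · rw [homogeneousComponent_of_mem (isHomogeneous_monomial _ rfl), if_neg h.ne, map_zero,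
      bind₁_monomial, homogeneousComponent_C_mul,
      h1.1.homogeneousComponent_eq_zero (show m < ∑ i ∈ s.support, s i from h), mul_zero]

theorem eq_zero_of_forall_orderGE {p : MvPolynomial σ R}
    (h : ∀ m, OrderGE m p → homogeneousComponent m p = 0) : p = 0 := by
  classical
  have h1 : ∀ m, OrderGE m p := by
    intro m
    induction m with
    | zero => exact fun s hs => absurd hs (Nat.not_lt_zero _)
    | succ m ih =>
      intro s hs
      rcases (Nat.lt_succ_iff.1 hs).lt_or_eq with h2 | h2
      · exact ih s h2
      · have := congrArg (coeff s) (h m ih)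
        rwa [coeff_homogeneousComponent, if_pos h2, coeff_zero] at this
  ext s
  exact h1 (s.degree + 1) s (Nat.lt_succ_self _)

end Order

/-! ### Substitutions with Jacobian determinant `1` over an arbitrary ring. -/

namespace PolyEnd

variable {n : ℕ} {R : Type u} [CommRing R]

theorem eq_zero_of_linear_bind₁_eq_zero {J : Matrix (Fin n) (Fin n) R} (hJ : J.det = 1)
    {p : MvPolynomial (Fin n) R} (hp : bind₁ (fun i => ∑ j, C (J i j) * X j) p = 0) : p = 0 := by
  have h := congrArg (bind₁ fun i => ∑ j, C (J⁻¹ i j) * (X j : MvPolynomial (Fin n) R)) hp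
  rw [bind₁_bind₁, map_zero] at h
  have e : (fun i => bind₁ (fun i => ∑ j, C (J⁻¹ i j) * (X j : MvPolynomial (Fin n) R))
      (∑ j, C (J i j) * X j)) = X := by
    funext i
    simp only [map_sum, map_mul, bind₁_C_right, bind₁_X_right, Finset.mul_sum]
    rw [Finset.sum_comm]
    have : ∀ l, ∑ j, C (J i j) * (C (J⁻¹ j l) * X l) =
        C ((1 : Matrix (Fin n) (Fin n) R) i l) * (X l : MvPolynomial (Fin n) R) := by
      intro l
      rw [← Matrix.mul_nonsing_inv J (by rw [hJ]; exact isUnit_one), Matrix.mul_apply, map_sum,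
        Finset.sum_mul]
      exact Finset.sum_congr rfl fun j _ => by rw [C_mul, mul_assoc]
    simp only [this, Matrix.one_apply]
    simp
  rwa [e, ← aeval_eq_bind₁, aeval_X_left_apply] at h

theorem homogeneousComponent_one_eq (p : MvPolynomial (Fin n) R) :
    homogeneousComponent 1 p = ∑ j, C (eval 0 (pderiv j p)) * X j := by
  have h : ∀ j, eval 0 (pderiv j p) = coeff (Finsupp.single j 1) p := by
    intro j
    rw [eval_zero, constantCoeff_eq, coeff_pderiv]
    simp
  ext s
  rw [coeff_homogeneousComponent, coeff_sum]
  simp only [h, coeff_C_mul, coeff_X]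
  split_ifs with hs
  · obtain ⟨i, rfl⟩ : s ∈ Set.range fun a : Fin n => Finsupp.single a 1 := by
      rw [Finsupp.range_single_one]
      exact hs
    rw [Finset.sum_eq_single i]
    · simp
    · intro j _ hj
      rw [if_neg (by simpa [Finsupp.single_left_inj] using hj), mul_zero]
    · simp
  · refine (Finset.sum_eq_zero fun j _ => ?_).symm
    rw [if_neg, mul_zero]
    rintro rfl
    simp at hs

/-- After a translation `u` fixes the origin and acts on the lowest part of a polynomial through its
linear part, which has determinant `1`. No inverse of `u` is assumed, so this applies to reductions
over a residue field. -/
theorem eq_zero_of_bind₁_eq_zero {u : PolyEnd n R} (hu : u.jac = 1)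
    {p : MvPolynomial (Fin n) R} (hp : bind₁ u.comp p = 0) : p = 0 := by
  let c : Fin n → R := fun i => coeff 0 (u.comp i)
  let w : Fin n → MvPolynomial (Fin n) R := fun i => u.comp i - C (c i)
  let q := bind₁ (fun i => X i + C (c i)) p
  have hq : bind₁ w q = 0 := by
    rw [bind₁_bind₁, ← hp]
    congr 2
    funext i
    simp [w]
  have hw : ∀ i, OrderGE 1 (w i) := by
    intro i s hs
    rw [Nat.lt_one_iff, Finsupp.degree_eq_zero_iff] at hs
    subst hs
    simp [w, c]
  have hlin : (fun i => homogeneousComponent 1 (w i)) =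
      fun i => ∑ j, C ((Matrix.of fun i j => eval 0 (pderiv j (u.comp i))) i j) * X j := by
    funext i
    rw [homogeneousComponent_one_eq]
    simp [w]
  have hdet : (Matrix.of fun i j => eval 0 (pderiv j (u.comp i))).det = 1 := by
    have := congrArg (eval 0) hu
    rw [jac, RingHom.map_det, map_one] at this
    exact this
  have hq0 : q = 0 := by
    refine eq_zero_of_forall_orderGE fun m hm => ?_
    have h1 := OrderGE.homogeneousComponent_bind₁ hw hm
    rw [hq, map_zero, hlin] at h1
    exact eq_zero_of_linear_bind₁_eq_zero hdet h1.symm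
  have h2 := congrArg (bind₁ fun i => X i - C (c i)) hq0
  rw [map_zero, bind₁_bind₁] at h2
  rw [← h2]
  conv_lhs => rw [← aeval_X_left_apply p, aeval_eq_bind₁]
  congr 2
  funext i
  simp

/-! ### Change of coefficient ring. -/

section Map

variable {n : ℕ} {R S T : Type u} [CommRing R] [CommRing S] [CommRing T]

/-- The endomorphism obtained by applying a ring homomorphism to the coefficients. -/
def map (φ : R →+* S) : PolyEnd n R →* PolyEnd n S where
  toFun f := ⟨fun i => MvPolynomial.map φ (f.comp i)⟩
  map_one' := by
    ext1
    funext i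
    exact map_X φ i
  map_mul' f g := by
    ext1
    funext i
    exact map_bind₁ φ g.comp (f.comp i)

theorem map_comp (φ : R →+* S) (f : PolyEnd n R) (i : Fin n) :
    (f.map φ).comp i = MvPolynomial.map φ (f.comp i) := rfl

theorem map_map (φ : R →+* S) (ψ : S →+* T) (f : PolyEnd n R) :
    (f.map φ).map ψ = f.map (ψ.comp φ) := by
  ext1
  funext i
  exact MvPolynomial.map_map φ ψ (f.comp i)

theorem map_id (f : PolyEnd n R) : f.map (RingHom.id R) = f := by
  ext1
  funext i
  exact MvPolynomial.map_id (f.comp i)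

theorem map_injective {φ : R →+* S} (hφ : Function.Injective φ) :
    Function.Injective (map φ : PolyEnd n R → PolyEnd n S) := by
  intro f g h
  ext1
  funext i
  exact MvPolynomial.map_injective φ hφ (congrFun (congrArg comp h) i)

theorem jac_map (φ : R →+* S) (f : PolyEnd n R) : (f.map φ).jac = MvPolynomial.map φ f.jac := by
  unfold jac
  rw [RingHom.map_det]
  congr 1
  ext1 i j
  exact pderiv_map

theorem deg_map_le (φ : R →+* S) (f : PolyEnd n R) : (f.map φ).deg ≤ f.deg :=
  deg_le_iff.2 fun i => (Finset.sup_mono (support_map_subset φ _)).trans (f.totalDegree_comp_le i)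

theorem eval_map_comp {σ : Type*} (φ : R →+* S) (y : σ → R) (p : MvPolynomial σ R) :
    eval (fun i => φ (y i)) (MvPolynomial.map φ p) = φ (eval y p) := by
  rw [MvPolynomial.eval_map, MvPolynomial.eval₂_comp]
  rfl

theorem evalAt_mul (f g : PolyEnd n R) (x : Fin n → R) :
    (f * g).evalAt x = f.evalAt (g.evalAt x) := by
  funext i
  exact (aeval_bind₁ x g.comp (f.comp i) :)

theorem exists_mvPolynomial_map_eq {σ : Type*} {φ : R →+* S} {p : MvPolynomial σ S}
    (hp : ∀ s, coeff s p ∈ φ.range) : ∃ p', MvPolynomial.map φ p' = p := by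
  choose c hc using hp
  refine ⟨∑ s ∈ p.support, monomial s (c s), ?_⟩
  simp only [map_sum, map_monomial, hc]
  exact p.as_sum.symm

theorem exists_map_eq {φ : R →+* S} {f : PolyEnd n S}
    (hf : ∀ i s, coeff s (f.comp i) ∈ φ.range) : ∃ f' : PolyEnd n R, f'.map φ = f := by
  choose p hp using fun i => exists_mvPolynomial_map_eq (hf i)
  exact ⟨⟨p⟩, by ext1; exact funext hp⟩

end Map

/-! ### Gauss norms, and integrality of inverses. -/

section Valuation

variable {K : Type u} [Field K] (O : ValuationSubring K)

theorem exists_coeff_max {n : ℕ} {f : PolyEnd n K} (hf : ¬ ∀ i s, coeff s (f.comp i) ∈ O) :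
    ∃ i s, coeff s (f.comp i) ≠ 0 ∧ 1 < O.valuation (coeff s (f.comp i)) ∧
      ∀ j t, O.valuation (coeff t (f.comp j)) ≤ O.valuation (coeff s (f.comp i)) := by
  classical
  push Not at hf
  obtain ⟨i₀, s₀, h₀⟩ := hf
  rw [← O.valuation_le_one_iff, not_le] at h₀
  let T : Finset (Σ _ : Fin n, Fin n →₀ ℕ) := Finset.univ.sigma fun i => (f.comp i).support
  have hmem : ∀ i s, coeff s (f.comp i) ≠ 0 → (⟨i, s⟩ : Σ _ : Fin n, Fin n →₀ ℕ) ∈ T :=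
    fun i s h => Finset.mem_sigma.2 ⟨Finset.mem_univ _, mem_support_iff.2 h⟩
  have h₁ : coeff s₀ (f.comp i₀) ≠ 0 := by
    intro h
    rw [h, map_zero] at h₀
    exact not_lt_zero h₀
  obtain ⟨⟨i, s⟩, his, hmax⟩ := T.exists_max_image
    (fun x => O.valuation (coeff x.2 (f.comp x.1))) ⟨_, hmem i₀ s₀ h₁⟩
  refine ⟨i, s, mem_support_iff.1 (Finset.mem_sigma.1 his).2,
    h₀.trans_le (hmax _ (hmem i₀ s₀ h₁)), fun j t => ?_⟩
  by_cases h : coeff t (f.comp j) = 0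
  · rw [h, map_zero]
    exact zero_le
  · exact hmax _ (hmem j t h)

theorem valuation_eval_le {n : ℕ} {p : MvPolynomial (Fin n) K} {d : ℕ} {M c : O.ValueGroup}
    (hp : ∀ s, O.valuation (coeff s p) ≤ c) (hd : p.totalDegree ≤ d) (hM : 1 ≤ M)
    {x : Fin n → K} (hx : ∀ i, O.valuation (x i) ≤ M) : O.valuation (eval x p) ≤ c * M ^ d := by
  rw [eval_eq]
  refine O.valuation.map_sum_le fun s hs => ?_
  rw [map_mul, map_prod]
  refine mul_le_mul' (hp s) ?_
  calc _ ≤ ∏ i ∈ s.support, M ^ s i := Finset.prod_le_prod' fun i _ => by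
        rw [map_pow]
        exact pow_le_pow_left' (hx i) _
    _ = M ^ (∑ i ∈ s.support, s i) := Finset.prod_pow_eq_pow_sum _ _ _
    _ ≤ M ^ d := pow_le_pow_right' hM ((le_totalDegree hs).trans hd)

theorem exists_map_eq_C_inv_mul {σ : Type*} {p : MvPolynomial σ K} {c : K} (hc : c ≠ 0)
    (hp : ∀ s, O.valuation (coeff s p) ≤ O.valuation c) {s : σ →₀ ℕ} (hs : coeff s p = c) :
    ∃ p' : MvPolynomial σ O, MvPolynomial.map O.subtype p' = C c⁻¹ * p ∧
      MvPolynomial.map (IsLocalRing.residue O) p' ≠ 0 := by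
  have hc' : O.valuation c ≠ 0 := (Valuation.ne_zero_iff _).2 hc
  obtain ⟨p', hp'⟩ := exists_mvPolynomial_map_eq (φ := O.subtype) (p := C c⁻¹ * p) fun s => by
    refine ⟨⟨coeff s (C c⁻¹ * p), ?_⟩, rfl⟩
    rw [← O.valuation_le_one_iff, coeff_C_mul, map_mul, map_inv₀, inv_mul_le_iff₀ (zero_lt_iff.2 hc'),
      mul_one]
    exact hp s
  refine ⟨p', hp', fun h => ?_⟩
  have h1 : coeff s p' = 1 := by
    apply O.subtype_injective
    rw [← coeff_map, hp', coeff_C_mul, hs, inv_mul_cancel₀ hc, map_one]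
  have h2 := congrArg (coeff s) h
  rw [coeff_map, h1, map_one, coeff_zero] at h2
  exact one_ne_zero h2

/-- A polynomial over a valued field attains its Gauss norm on every box whose sides consist of
infinitely many constants. -/
theorem exists_valuation_eval_eq {n : ℕ} {k : Type u} [Field k] [Infinite k] {ι : k →+* K}
    (hι : ∀ c, ι c ∈ O) {p : MvPolynomial (Fin n) K} {c : K} (hc : c ≠ 0)
    (hp : ∀ s, O.valuation (coeff s p) ≤ O.valuation c) {s : Fin n →₀ ℕ} (hs : coeff s p = c) :
    ∃ y : Fin n → k, O.valuation (eval (fun i => ι (y i)) p) = O.valuation c := by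
  obtain ⟨p', hp', hne⟩ := exists_map_eq_C_inv_mul O hc hp hs
  let ι' : k →+* O := ι.codRestrict O hι
  let ρ := (IsLocalRing.residue O).comp ι'
  have : ∃ y : Fin n → k, eval (fun i => ρ (y i)) (MvPolynomial.map (IsLocalRing.residue O) p') ≠ 0 := by
    by_contra! h
    refine hne (MvPolynomial.funext_set (fun _ => Set.range ρ)
      (fun _ => Set.infinite_range_of_injective ρ.injective) fun x hx => ?_)
    choose y hy using fun i => hx i (Set.mem_univ i)
    rw [map_zero, ← h y]
    congr 2
    exact (funext hy).symm
  obtain ⟨y, hy⟩ := this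
  refine ⟨y, ?_⟩
  have h1 := eval_map_comp (IsLocalRing.residue O) (fun i => ι' (y i)) p'
  rw [show (fun i => IsLocalRing.residue O (ι' (y i))) = fun i => ρ (y i) from rfl] at h1
  rw [h1, IsLocalRing.residue_ne_zero_iff_isUnit, O.valuation_eq_one_iff] at hy
  have h2 := eval_map_comp O.subtype (fun i => ι' (y i)) p'
  rw [hp', map_mul, eval_C] at h2
  have h3 : O.valuation (c⁻¹ * eval (fun i => ι (y i)) p) = 1 := by
    rw [← hy]
    exact congrArg O.valuation h2
  rw [map_mul, map_inv₀] at h3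
  exact (eq_of_inv_mul_eq_one h3).symm

/-- If the inverse of an endomorphism with Jacobian determinant `1` over a valuation ring exists
over the field of fractions, then it is defined over the valuation ring. -/
theorem coeff_mem_of_mul_eq_one {n : ℕ} {u h : PolyEnd n K} (hu : ∀ i s, coeff s (u.comp i) ∈ O)
    (hjac : u.jac = 1) (hhu : h * u = 1) : ∀ i s, coeff s (h.comp i) ∈ O := by
  by_contra hh
  obtain ⟨i, s, hc, h1, hmax⟩ := exists_coeff_max O hh
  set c := coeff s (h.comp i) with hcdef
  obtain ⟨p, hp, hp0⟩ := exists_map_eq_C_inv_mul O hc (hmax i) hcdef.symm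
  obtain ⟨u', rfl⟩ := exists_map_eq (φ := O.subtype) fun i s => ⟨⟨_, hu i s⟩, rfl⟩
  have hinj := MvPolynomial.map_injective (σ := Fin n) O.subtype O.subtype_injective
  have hjac' : u'.jac = 1 := by
    rw [jac_map, ← map_one (MvPolynomial.map O.subtype)] at hjac
    exact hinj hjac
  have hc' : O.valuation c⁻¹ < 1 := by
    rw [map_inv₀]
    exact inv_lt_one_of_one_lt₀ h1
  let c' : O := ⟨c⁻¹, O.mem_of_valuation_le_one _ hc'.le⟩
  -- This is `h * u = 1` divided by the coefficient `c` of largest valuation. Its right side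
  -- vanishes in the residue field, whereas the reduction of `p` does not.
  have h2 : bind₁ u'.comp p = C c' * X i := by
    apply hinj
    rw [map_bind₁, hp, map_mul, map_mul, map_C, map_X, bind₁_C_right]
    change C c⁻¹ * (h * u'.map O.subtype).comp i = C c⁻¹ * X i
    rw [hhu, one_comp]
  refine hp0 (eq_zero_of_bind₁_eq_zero (u := u'.map (IsLocalRing.residue O)) ?_ ?_)
  · rw [jac_map, hjac', map_one]
  · have h3 := congrArg (MvPolynomial.map (IsLocalRing.residue O)) h2
    rw [map_bind₁, map_mul, map_C, (IsLocalRing.residue_eq_zero_iff c').2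
      ((O.valuation_lt_one_iff c').2 hc'), C_0, zero_mul] at h3
    exact h3

end Valuation
-- Expansion outside the unit polydisc.
section Valuation

variable {K : Type u} [Field K] (O : ValuationSubring K) {k : Type u} [Field k] {ι : k →+* K}

theorem valuation_const_le (hι : ∀ c, ι c ∈ O) (c : k) : O.valuation (ι c) ≤ 1 :=
  (O.valuation_le_one_iff _).2 (hι c)

theorem valuation_const_eq (hι : ∀ c, ι c ∈ O) {c : k} (hc : c ≠ 0) : O.valuation (ι c) = 1 := by
  refine le_antisymm (valuation_const_le O hι c) ?_
  have h := valuation_const_le O hι c⁻¹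
  rw [map_inv₀, map_inv₀] at h
  exact (inv_le_one₀ (zero_lt_iff.2 ((Valuation.ne_zero_iff _).2 (by simpa using hc)))).1 h

theorem map_linForm (l : Fin 2 → k) :
    MvPolynomial.map ι (linForm l) = linForm (fun i => ι (l i)) := by
  simp [linForm]

theorem totalDegree_sub_homogeneousComponent_lt {p : MvPolynomial (Fin 2) k} {d : ℕ} (hd : 0 < d)
    (hp : p.totalDegree ≤ d) : (p - homogeneousComponent d p).totalDegree ≤ d - 1 := by
  refine Finset.sup_le fun s hs => ?_
  rw [mem_support_iff, coeff_sub, coeff_homogeneousComponent] at hs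
  change s.degree ≤ d - 1
  by_cases h : s.degree = d
  · simp [h] at hs
  · rw [if_neg h, sub_zero] at hs
    have : s.degree ≤ p.totalDegree := le_totalDegree (mem_support_iff.2 hs)
    omega

/-- The top part has norm `M ^ deg f` and dominates the remaining terms, of norm at most `M ^ (deg f
- 1)`. -/
theorem IsTop.exists_valuation_evalAt_eq (hι : ∀ c, ι c ∈ O) {f : PolyEnd 2 k} {l a : Fin 2 → k}
    (hf : f.IsTop l a) (hd : 0 < f.deg) {x : Fin 2 → K} {M : O.ValueGroup} (hM : 1 < M)
    (hx : ∀ i, O.valuation (x i) ≤ M)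
    (hl : O.valuation (eval x (linForm fun i => ι (l i))) = M) :
    ∃ j, O.valuation ((f.map ι).evalAt x j) = M ^ f.deg := by
  obtain ⟨j, hj⟩ := hf.exists_vec_ne_zero
  refine ⟨j, ?_⟩
  have h1 : (f.map ι).evalAt x j = eval x (MvPolynomial.map ι (f.comp j - f.top j)) +
      eval x (MvPolynomial.map ι (f.top j)) := by
    rw [← map_add, ← map_add, sub_add_cancel]
    rfl
  have h2 : O.valuation (eval x (MvPolynomial.map ι (f.top j))) = M ^ f.deg := by
    rw [hf.top_eq, map_mul, map_pow, map_C, map_linForm, map_mul, map_pow, map_mul, map_pow, hl,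
      eval_C, valuation_const_eq O hι hj, one_mul]
  have h3 : O.valuation (eval x (MvPolynomial.map ι (f.comp j - f.top j))) ≤
      1 * M ^ (f.deg - 1) :=
    valuation_eval_le O (fun s => by rw [coeff_map]; exact valuation_const_le O hι _)
      ((Finset.sup_mono (support_map_subset ι _)).trans
        (totalDegree_sub_homogeneousComponent_lt hd (f.totalDegree_comp_le j))) hM.le hx
  rw [one_mul] at h3
  rw [h1, Valuation.map_add_eq_of_lt_right, h2]
  rw [h2]
  exact h3.trans_lt (pow_lt_pow_right₀ hM (by omega))

/-- By Cramer's rule each coordinate is a combination of the two forms with constant coefficients,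
and nonzero constants have norm `1`. -/
theorem eq_or_eq_of_independent (hι : ∀ c, ι c ∈ O) {l l' : Fin 2 → k}
    (h : l 0 * l' 1 - l 1 * l' 0 ≠ 0) {x : Fin 2 → K} {M : O.ValueGroup}
    (hx : ∀ i, O.valuation (x i) ≤ M) {i : Fin 2} (hi : O.valuation (x i) = M) :
    O.valuation (eval x (linForm fun i => ι (l i))) = M ∨
      O.valuation (eval x (linForm fun i => ι (l' i))) = M := by
  have hle : ∀ m : Fin 2 → k, O.valuation (eval x (linForm fun i => ι (m i))) ≤ M := by
    intro m
    rw [eval_linForm]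
    have key : ∀ j, O.valuation (ι (m j) * x j) ≤ M := fun j => by
      rw [map_mul]
      exact (mul_le_mul' (valuation_const_le O hι _) (hx j)).trans_eq (one_mul M)
    exact O.valuation.map_add_le (key 0) (key 1)
  by_contra! hne
  have h1 := lt_of_le_of_ne (hle l) hne.1
  have h2 := lt_of_le_of_ne (hle l') hne.2
  have key : ∀ b b' : k, O.valuation (ι b * eval x (linForm fun i => ι (l i)) +
      ι b' * eval x (linForm fun i => ι (l' i))) < M := by
    intro b b'
    refine O.valuation.map_add_lt ?_ ?_ <;> rw [map_mul]
    · exact (mul_le_mul' (valuation_const_le O hι b) le_rfl).trans_lt (by rwa [one_mul])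
    · exact (mul_le_mul' (valuation_const_le O hι b') le_rfl).trans_lt (by rwa [one_mul])
  have h3 : O.valuation (ι (l 0 * l' 1 - l 1 * l' 0) * x i) = M := by
    rw [map_mul, valuation_const_eq O hι h, one_mul, hi]
  refine absurd h3 (ne_of_lt ?_)
  fin_cases i
  · convert key (l' 1) (-l 1) using 2
    simp [eval_linForm]
    ring
  · convert key (-l' 0) (l 0) using 2
    simp [eval_linForm]
    ring

/-- The endomorphism `f` expands the complement of the unit polydisc, along with `f'`, in the sense
that one of the two sends any given point further away. Hence an endomorphism semiconjugating
endomorphisms defined over the valuation ring to `f` and `f'` preserves the polydisc. -/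
theorem coeff_mem_of_semiconj [Infinite k] (hι : ∀ c, ι c ∈ O) {f f' : PolyEnd 2 k}
    {l a l' a' : Fin 2 → k} (hf : f.IsTop l a) (hf' : f'.IsTop l' a') (hd : 2 ≤ f.deg)
    (hd' : 2 ≤ f'.deg) (hll' : l 0 * l' 1 - l 1 * l' 0 ≠ 0) {u g g' : PolyEnd 2 K}
    (hg : ∀ i s, coeff s (g.comp i) ∈ O) (hg' : ∀ i s, coeff s (g'.comp i) ∈ O)
    (h : u * g = f.map ι * u) (h' : u * g' = f'.map ι * u) :
    ∀ i s, coeff s (u.comp i) ∈ O := by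
  by_contra hu
  obtain ⟨i, s, hc, hM, hmax⟩ := exists_coeff_max O hu
  obtain ⟨y, hy⟩ := exists_valuation_eval_eq O hι hc (hmax i) rfl
  set M := O.valuation (coeff s (u.comp i))
  have hbound : ∀ z : Fin 2 → K, (∀ j, O.valuation (z j) ≤ 1) →
      ∀ j, O.valuation (u.evalAt z j) ≤ M := by
    intro z hz j
    exact (valuation_eval_le O (hmax j) le_rfl le_rfl hz).trans_eq (by rw [one_pow, mul_one])
  have hy1 : ∀ j, O.valuation (ι (y j)) ≤ 1 := fun j => valuation_const_le O hι _
  have hO : ∀ g : PolyEnd 2 K, (∀ i s, coeff s (g.comp i) ∈ O) →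
      ∀ j, O.valuation (g.evalAt (fun i => ι (y i)) j) ≤ 1 := by
    intro g hg j
    exact (valuation_eval_le O (fun s => (O.valuation_le_one_iff _).2 (hg j s)) le_rfl
      le_rfl hy1).trans_eq (by rw [one_pow, mul_one])
  have hlt : ∀ d, 2 ≤ d → M < M ^ d := fun d hd => by
    simpa using pow_lt_pow_right₀ hM (show 1 < d by omega)
  have key : ∀ f : PolyEnd 2 k, ∀ g : PolyEnd 2 K, (∀ i s, coeff s (g.comp i) ∈ O) →
      u * g = f.map ι * u → ∀ j,
        O.valuation ((f.map ι).evalAt (u.evalAt fun i => ι (y i)) j) ≤ M := by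
    intro f g hg h j
    rw [← evalAt_mul, ← h, evalAt_mul]
    exact hbound _ (hO g hg) j
  -- The point `u(y)` has norm `M > 1`, so `f` or `f'` sends it to norm at least `M²`. But this
  -- image is also `u(g(y))` or `u(g'(y))`, of norm at most `M`.
  rcases eq_or_eq_of_independent O hι hll' (hbound _ hy1) (i := i) hy with h1 | h1
  · obtain ⟨j, hj⟩ := hf.exists_valuation_evalAt_eq O hι (by omega) hM (hbound _ hy1) h1
    exact absurd (key f g hg h j) (by rw [hj]; exact not_le.2 (hlt _ hd))
  · obtain ⟨j, hj⟩ := hf'.exists_valuation_evalAt_eq O hι (by omega) hM (hbound _ hy1) h1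
    exact absurd (key f' g' hg' h' j) (by rw [hj]; exact not_le.2 (hlt _ hd'))

end Valuation
-- Conjugators over rings, and their descent to `k`.
section Conjugator

variable {R S : Type u} [CommRing R] [CommRing S]

/-- The endomorphism `h`, with inverse `h'` and Jacobian determinant `1`, conjugates `f` to `g` and
`f'` to `g'`. -/
structure IsConjugator (f f' g g' h h' : PolyEnd 2 R) : Prop where
  mul_inv : h * h' = 1
  inv_mul : h' * h = 1
  jac_eq_one : h.jac = 1
  semiconj : g * h = h * f
  semiconj' : g' * h = h * f'

variable {f f' g g' h h' : PolyEnd 2 R}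

theorem IsConjugator.map (H : IsConjugator f f' g g' h h') (φ : R →+* S) :
    IsConjugator (f.map φ) (f'.map φ) (g.map φ) (g'.map φ) (h.map φ) (h'.map φ) where
  mul_inv := by rw [← map_mul, H.mul_inv, map_one]
  inv_mul := by rw [← map_mul, H.inv_mul, map_one]
  jac_eq_one := by rw [jac_map, H.jac_eq_one, map_one]
  semiconj := by rw [← map_mul, H.semiconj, map_mul]
  semiconj' := by rw [← map_mul, H.semiconj', map_mul]

theorem IsConjugator.of_map_injective {φ : R →+* S} (hφ : Function.Injective φ)
    (H : IsConjugator (f.map φ) (f'.map φ) (g.map φ) (g'.map φ) (h.map φ) (h'.map φ)) :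
    IsConjugator f f' g g' h h' where
  mul_inv := map_injective hφ (by rw [map_mul, H.mul_inv, map_one])
  inv_mul := map_injective hφ (by rw [map_mul, H.inv_mul, map_one])
  jac_eq_one := MvPolynomial.map_injective φ hφ (by rw [← jac_map, H.jac_eq_one, map_one])
  semiconj := map_injective hφ (by rw [map_mul, H.semiconj, map_mul])
  semiconj' := map_injective hφ (by rw [map_mul, H.semiconj', map_mul])

theorem IsConjugator.jac_inv (H : IsConjugator f f' g g' h h') : h'.jac = 1 := by
  have := jac_mul h h'
  rw [H.mul_inv, jac_one, H.jac_eq_one, map_one, one_mul] at this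
  exact this.symm

theorem inv_mul_eq_of_mul_eq {M : Type*} [Monoid M] {f g h h' : M} (h1 : h * h' = 1)
    (h2 : h' * h = 1) (h3 : g * h = h * f) : h' * g = f * h' := by
  calc h' * g = h' * (g * h) * h' := by rw [mul_assoc, mul_assoc, h1, mul_one]
    _ = f * h' := by rw [h3, ← mul_assoc, h2, one_mul]

section Pi

variable {A k : Type u} [CommRing k]

theorem map_pi_ext {n : ℕ} {f g : PolyEnd n (A → k)}
    (h : ∀ a, f.map (Pi.evalRingHom (fun _ => k) a) = g.map (Pi.evalRingHom (fun _ => k) a)) :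
    f = g := by
  ext1
  funext i
  ext s a
  have := congrArg (coeff s) (congrFun (congrArg comp (h a)) i)
  simpa [map_comp, coeff_map] using this

theorem jac_eq_one_of_pi {n : ℕ} {f : PolyEnd n (A → k)}
    (h : ∀ a, (f.map (Pi.evalRingHom (fun _ => k) a)).jac = 1) : f.jac = 1 := by
  ext s a
  have := congrArg (coeff s) (h a)
  rw [jac_map, coeff_map, ← map_one (MvPolynomial.map (Pi.evalRingHom (fun _ => k) a)),
    coeff_map] at this
  exact this

theorem IsConjugator.of_pi {f f' g g' h h' : PolyEnd 2 (A → k)}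
    (H : ∀ a, let φ := Pi.evalRingHom (fun _ : A => k) a
      IsConjugator (f.map φ) (f'.map φ) (g.map φ) (g'.map φ) (h.map φ) (h'.map φ)) :
    IsConjugator f f' g g' h h' where
  mul_inv := map_pi_ext fun a => by rw [map_mul, (H a).mul_inv, map_one]
  inv_mul := map_pi_ext fun a => by rw [map_mul, (H a).inv_mul, map_one]
  jac_eq_one := jac_eq_one_of_pi fun a => (H a).jac_eq_one
  semiconj := map_pi_ext fun a => by rw [map_mul, (H a).semiconj, map_mul]
  semiconj' := map_pi_ext fun a => by rw [map_mul, (H a).semiconj', map_mul]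

/-- A family of endomorphisms of bounded degree is an endomorphism over the product ring. -/
theorem exists_pi_lift {n N : ℕ} (f : A → PolyEnd n k) (hf : ∀ a, (f a).deg ≤ N) :
    ∃ F : PolyEnd n (A → k), ∀ a, F.map (Pi.evalRingHom (fun _ => k) a) = f a := by
  let T := (Finsupp.finite_of_degree_le (σ := Fin n) N).toFinset
  refine ⟨⟨fun i => ∑ s ∈ T, monomial s fun a => coeff s ((f a).comp i)⟩, fun a => ?_⟩
  ext1
  funext i
  rw [map_comp, map_sum]
  simp only [map_monomial, Pi.evalRingHom_apply]
  refine (Finset.sum_subset (s₁ := ((f a).comp i).support) (fun s hs => ?_) fun s _ hs => ?_).symm.trans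
    ((f a).comp i).as_sum.symm
  · rw [Set.Finite.mem_toFinset]
    exact (le_totalDegree hs).trans (((f a).totalDegree_comp_le i).trans (hf a))
  · rw [notMem_support_iff.1 hs, map_zero]

end Pi

section Descent

variable {k : Type u} [Field k] [IsAlgClosed k]

theorem nonempty_algHom_of_finiteType (A : Type u) [CommRing A] [Nontrivial A] [Algebra k A]
    [Algebra.FiniteType k A] : Nonempty (A →ₐ[k] k) := by
  obtain ⟨m, hm⟩ := Ideal.exists_maximal A
  let _ := Ideal.Quotient.field m
  have : Algebra.FiniteType k (A ⧸ m) :=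
    Algebra.FiniteType.of_surjective (Ideal.Quotient.mkₐ k m) (Ideal.Quotient.mkₐ_surjective k m)
  have : Module.Finite k (A ⧸ m) := finite_of_finite_type_of_isJacobsonRing k (A ⧸ m)
  exact ⟨((AlgEquiv.ofBijective (Algebra.ofId k (A ⧸ m))
    IsAlgClosed.algebraMap_bijective_of_isIntegral).symm : (A ⧸ m) →ₐ[k] k).comp
      (Ideal.Quotient.mkₐ k m)⟩

/-- The coefficients of `h` and `h'` generate a finitely generated `k`-algebra. By the
Nullstellensatz it has a `k`-point, and specialising there leaves `f` and `g` unchanged. -/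
theorem IsConjugator.descend {κ : Type u} [CommRing κ] [Nontrivial κ] (ι : k →+* κ)
    {f f' g g' : PolyEnd 2 k} {h h' : PolyEnd 2 κ}
    (H : IsConjugator (f.map ι) (f'.map ι) (g.map ι) (g'.map ι) h h') :
    ∃ h h' : PolyEnd 2 k, IsConjugator f f' g g' h h' := by
  classical
  let _ := ι.toAlgebra
  let T : Finset κ := Finset.univ.biUnion fun i =>
    (h.comp i).support.image (fun s => coeff s (h.comp i)) ∪
      (h'.comp i).support.image (fun s => coeff s (h'.comp i))
  let A := Algebra.adjoin k (T : Set κ)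
  have : Algebra.FiniteType k A := (Subalgebra.fg_iff_finiteType _).1 (Subalgebra.fg_adjoin_finset T)
  have hmem : ∀ i s, coeff s (h.comp i) ∈ A ∧ coeff s (h'.comp i) ∈ A := by
    intro i s
    constructor
    · by_cases hs : coeff s (h.comp i) = 0
      · rw [hs]; exact A.zero_mem
      · refine Algebra.subset_adjoin (Finset.mem_coe.2 (Finset.mem_biUnion.2
          ⟨i, Finset.mem_univ _, Finset.mem_union_left _ (Finset.mem_image_of_mem _ ?_)⟩))
        exact mem_support_iff.2 hs
    · by_cases hs : coeff s (h'.comp i) = 0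
      · rw [hs]; exact A.zero_mem
      · refine Algebra.subset_adjoin (Finset.mem_coe.2 (Finset.mem_biUnion.2
          ⟨i, Finset.mem_univ _, Finset.mem_union_right _ (Finset.mem_image_of_mem _ ?_)⟩))
        exact mem_support_iff.2 hs
  let φ : A →+* κ := A.val.toRingHom
  have hφ : Function.Injective φ := Subtype.val_injective
  obtain ⟨p, hp⟩ := exists_map_eq (φ := φ) fun i s => ⟨⟨_, (hmem i s).1⟩, rfl⟩
  obtain ⟨p', hp'⟩ := exists_map_eq (φ := φ) fun i s => ⟨⟨_, (hmem i s).2⟩, rfl⟩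
  have hι : ι = φ.comp (algebraMap k A) := rfl
  rw [hι, ← hp, ← hp'] at H
  simp only [← map_map] at H
  obtain ⟨σ⟩ := nonempty_algHom_of_finiteType (k := k) A
  have H' := (H.of_map_injective hφ).map σ.toRingHom
  simp only [map_map, show σ.toRingHom.comp (algebraMap k A) = RingHom.id k from
    σ.comp_algebraMap, map_id] at H'
  exact ⟨_, _, H'⟩

end Descent

end Conjugator
-- Specialisation of conjugators along a valuation.
section Specialization

theorem exists_valuationSubring_of_prime {B K : Type u} [CommRing B] [Field K] (β : B →+* K)
    (p : Ideal B) [p.IsPrime] (hp : RingHom.ker β ≤ p) :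
    ∃ O : ValuationSubring K, (∀ b, β b ∈ O) ∧ ∀ b ∈ p, O.valuation (β b) < 1 := by
  have hI : p.map β.rangeRestrict ≠ ⊤ := by
    intro h
    have h1 := (Ideal.eq_top_iff_one _).1 h
    obtain ⟨b, hb, hb1⟩ := (Ideal.mem_map_iff_of_surjective _ β.rangeRestrict_surjective).1 h1
    refine (Ideal.ne_top_iff_one p).1 (Ideal.IsPrime.ne_top inferInstance) ?_
    have h2 : b - 1 ∈ RingHom.ker β := by
      rw [RingHom.mem_ker, map_sub, map_one, sub_eq_zero]
      exact congrArg Subtype.val hb1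
    simpa using p.sub_mem hb (hp h2)
  obtain ⟨O, hO, hnon⟩ := Ideal.image_subset_nonunits_valuationSubring _ hI
  refine ⟨O, fun b => hO ⟨b, rfl⟩, fun b hb => ?_⟩
  exact O.mem_nonunits_iff.1 (hnon ⟨_, Ideal.mem_map_of_mem _ hb, rfl⟩)

variable {k : Type u} [Field k] [IsAlgClosed k]

theorem IsConjugator.exists_specialization {K : Type u} [Field K] {B : Type u} [CommRing B]
    {β : B →+* K} {ι : k →+* B} {f f' : PolyEnd 2 k} {l a l' a' : Fin 2 → k}
    (hf : f.IsTop l a) (hf' : f'.IsTop l' a') (hd : 2 ≤ f.deg) (hd' : 2 ≤ f'.deg)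
    (hll' : l 0 * l' 1 - l 1 * l' 0 ≠ 0) {g g' : PolyEnd 2 B} {h h' : PolyEnd 2 K}
    (H : IsConjugator (f.map (β.comp ι)) (f'.map (β.comp ι)) (g.map β) (g'.map β) h h')
    (α : B →+* k) (hαι : α.comp ι = RingHom.id k) (hα : RingHom.ker β ≤ RingHom.ker α) :
    ∃ h h' : PolyEnd 2 k, IsConjugator f f' (g.map α) (g'.map α) h h' := by
  have : (RingHom.ker α).IsPrime := RingHom.ker_isPrime α
  obtain ⟨O, hO, hlt⟩ := exists_valuationSubring_of_prime β (RingHom.ker α) hα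
  have hg : ∀ g : PolyEnd 2 B, ∀ i s, coeff s ((g.map β).comp i) ∈ O := fun g i s => by
    rw [map_comp, coeff_map]
    exact hO _
  have hh' : ∀ i s, coeff s (h'.comp i) ∈ O :=
    coeff_mem_of_semiconj O (fun c => hO (ι c)) hf hf' hd hd' hll' (hg g) (hg g')
      (inv_mul_eq_of_mul_eq H.mul_inv H.inv_mul H.semiconj)
      (inv_mul_eq_of_mul_eq H.mul_inv H.inv_mul H.semiconj')
  have hh : ∀ i s, coeff s (h.comp i) ∈ O := coeff_mem_of_mul_eq_one O hh' H.jac_inv H.mul_inv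
  obtain ⟨p, rfl⟩ := exists_map_eq (φ := O.subtype) fun i s => ⟨⟨_, hh i s⟩, rfl⟩
  obtain ⟨p', rfl⟩ := exists_map_eq (φ := O.subtype) fun i s => ⟨⟨_, hh' i s⟩, rfl⟩
  let βO : B →+* O := β.codRestrict O hO
  have hβ : β = O.subtype.comp βO := rfl
  rw [hβ, RingHom.comp_assoc] at H
  simp only [← map_map _ O.subtype] at H
  have H1 := (H.of_map_injective O.subtype_injective).map (IsLocalRing.residue O)
  set ρ := (IsLocalRing.residue O).comp (βO.comp ι) with hρ
  -- Since `b - ι (α b)` lies in the centre `ker α`, reducing `g` modulo the maximal ideal amounts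
  -- to specialising it by `α`.
  have hfac : (IsLocalRing.residue O).comp βO = ρ.comp α := by
    ext b
    have h1 : b - ι (α b) ∈ RingHom.ker α := by
      rw [RingHom.mem_ker, map_sub, sub_eq_zero]
      exact (congrArg (fun φ => φ (α b)) hαι).symm
    have h2 : IsLocalRing.residue O (βO (b - ι (α b))) = 0 := by
      rw [IsLocalRing.residue_eq_zero_iff, O.valuation_lt_one_iff]
      exact hlt _ h1
    rw [map_sub, map_sub, sub_eq_zero] at h2
    exact h2
  simp only [map_map, ← hρ, hfac] at H1
  simp only [← map_map α ρ] at H1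
  exact H1.descend

/-- The set of specialisations of `g` that are conjugate to `f`, by automorphisms of bounded degree
with Jacobian determinant `1`, is closed. -/
theorem IsConjugator.exists_of_closure {B : Type u} [CommRing B] {ι : k →+* B}
    {f f' : PolyEnd 2 k} {l a l' a' : Fin 2 → k}
    (hf : f.IsTop l a) (hf' : f'.IsTop l' a') (hd : 2 ≤ f.deg) (hd' : 2 ≤ f'.deg)
    (hll' : l 0 * l' 1 - l 1 * l' 0 ≠ 0) {g g' : PolyEnd 2 B} (N : ℕ) (S : Set (B →+* k))
    (hS : ∀ α ∈ S, α.comp ι = RingHom.id k ∧ ∃ h h' : PolyEnd 2 k,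
      IsConjugator f f' (g.map α) (g'.map α) h h' ∧ h.deg ≤ N ∧ h'.deg ≤ N)
    (α : B →+* k) (hαι : α.comp ι = RingHom.id k) (hα : ∀ b, (∀ γ ∈ S, γ b = 0) → α b = 0) :
    ∃ h h' : PolyEnd 2 k, IsConjugator f f' (g.map α) (g'.map α) h h' := by
  choose h h' hc hN hN' using fun γ : S => (hS γ.1 γ.2).2
  obtain ⟨P, hP⟩ := exists_pi_lift h hN
  obtain ⟨P', hP'⟩ := exists_pi_lift h' hN'
  let ψ : B →+* (S → k) := RingHom.pi fun γ : S => γ.1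
  have hψ : ∀ γ : S, (Pi.evalRingHom (fun _ : S => k) γ).comp ψ = γ.1 := fun γ => rfl
  have H : IsConjugator (f.map (ψ.comp ι)) (f'.map (ψ.comp ι)) (g.map ψ) (g'.map ψ) P P' := by
    refine IsConjugator.of_pi fun γ => ?_
    simp only [map_map, ← RingHom.comp_assoc, hψ, (hS γ.1 γ.2).1, map_id, hP, hP']
    exact hc γ
  have : (RingHom.ker α).IsPrime := RingHom.ker_isPrime α
  -- The kernel of `ψ` consists of the functions vanishing on `S`, so the closure hypothesis places
  -- it in `ker α`. The fraction field of the quotient by `q` then carries a conjugator.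
  obtain ⟨q, -, hq, hle⟩ := Ideal.exists_ideal_comap_le_prime (f := ψ) (RingHom.ker α) ⊥ (by
    intro b hb
    exact hα b fun γ hγ => congrFun hb ⟨γ, hγ⟩)
  let θ : (S → k) →+* FractionRing ((S → k) ⧸ q) :=
    (algebraMap ((S → k) ⧸ q) _).comp (Ideal.Quotient.mk q)
  have hker : RingHom.ker (θ.comp ψ) ≤ RingHom.ker α := by
    intro b hb
    refine hle ?_
    rw [Ideal.mem_comap, ← Ideal.Quotient.eq_zero_iff_mem]
    exact FaithfulSMul.algebraMap_injective _ (FractionRing ((S → k) ⧸ q))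
      ((RingHom.mem_ker.1 hb).trans (map_zero _).symm)
  have H1 := H.map θ
  simp only [map_map, ← RingHom.comp_assoc] at H1
  exact H1.exists_specialization hf hf' hd hd' hll' α hαι hker

end Specialization

end PolyEnd

/-! ### From morphisms of schemes to polynomials over an affine chart. -/

section Scheme

open CategoryTheory AlgebraicGeometry

section Geometry

variable {k : Type u} [Field k]

theorem Variety.Point.pair_appTop_coord {n : ℕ} {A : Variety k} (a : A.Point) (x : Fin n → k)
    (i : ULift.{u} (Fin n)) :
    (a.pair x).appTop (AffineSpace.coord A.scheme i) =
      (Scheme.ΓSpecIso (CommRingCat.of k)).inv (x i.down) :=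
  AffineSpace.homOfVector_appTop_coord _ _ _

theorem Variety.Point.pair_eq {n : ℕ} {A : Variety k} (a : A.Point) (x : Fin n → k)
    {B : CommRingCat.{u}} (j : Spec B ⟶ A.scheme) (α : B ⟶ CommRingCat.of k)
    (ha : a.1 = Spec.map α ≫ j) :
    a.pair x = Spec.map (CommRingCat.ofHom
        (eval₂Hom α.hom fun i : ULift.{u} (Fin n) => x i.down)) ≫
      (AffineSpace.SpecIso (ULift.{u} (Fin n)) B).inv ≫ AffineSpace.map _ j := by
  apply AffineSpace.hom_ext
  · rw [Variety.Point.pair, AffineSpace.homOfVector_over, Category.assoc, Category.assoc,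
      AffineSpace.map_over, AffineSpace.SpecIso_inv_over_assoc, ← Spec.map_comp_assoc, ha]
    congr 2
    ext b
    simp
  · intro i
    rw [Variety.Point.pair_appTop_coord, Scheme.Hom.comp_appTop, Scheme.Hom.comp_appTop,
      CommRingCat.comp_apply, CommRingCat.comp_apply, AffineSpace.map_appTop_coord,
      AffineSpace.SpecIso_inv_appTop_coord, ← CommRingCat.comp_apply,
      ← Scheme.ΓSpecIso_inv_naturality, CommRingCat.comp_apply]
    congr 1
    simp

/-- The pullbacks of the coordinates to affine space over `Spec B` are polynomials over `B`. Their
specialisations are determined by values at points, as `k` is infinite. -/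
theorem exists_polyEnd_of_morphism [Infinite k] {n : ℕ} {A : Variety k}
    (φ : 𝔸(ULift.{u} (Fin n); A.scheme) ⟶ 𝔸(ULift.{u} (Fin n); A.scheme))
    (E : A.Point → PolyEnd n k) (hE : ∀ (a : A.Point) (x : Fin n → k),
      a.pair x ≫ φ = a.pair ((E a).evalAt x))
    {B : CommRingCat.{u}} (j : Spec B ⟶ A.scheme) :
    ∃ g : PolyEnd n B, ∀ (a : A.Point) (α : B ⟶ CommRingCat.of k),
      a.1 = Spec.map α ≫ j → g.map α.hom = E a := by
  let Ψ := (AffineSpace.SpecIso (ULift.{u} (Fin n)) B).inv ≫ AffineSpace.map _ j ≫ φ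
  let p : ULift.{u} (Fin n) → MvPolynomial (ULift.{u} (Fin n)) B := fun i =>
    (Scheme.ΓSpecIso (CommRingCat.of (MvPolynomial (ULift.{u} (Fin n)) B))).hom
      (Ψ.appTop (AffineSpace.coord A.scheme i))
  refine ⟨⟨fun i => rename ULift.down (p ⟨i⟩)⟩, fun a α ha => ?_⟩
  ext1
  funext i
  refine MvPolynomial.funext fun x => ?_
  let ev : CommRingCat.of (MvPolynomial (ULift.{u} (Fin n)) B) ⟶ CommRingCat.of k :=
    CommRingCat.ofHom (eval₂Hom α.hom fun i : ULift.{u} (Fin n) => x i.down)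
  have h1 : Spec.map ev ≫ Ψ = a.pair ((E a).evalAt x) := by
    rw [← hE a x, a.pair_eq x j α ha, Category.assoc, Category.assoc]
  have h2 := congrArg (fun ψ => ψ.appTop (AffineSpace.coord A.scheme ⟨i⟩)) h1
  simp only [Variety.Point.pair_appTop_coord] at h2
  have h3 : ev (p ⟨i⟩) = (E a).evalAt x i := by
    have h4 := congrArg (Scheme.ΓSpecIso (CommRingCat.of k)).hom h2
    have h5 : ∀ y, (Scheme.ΓSpecIso (CommRingCat.of k)).hom
        ((Scheme.ΓSpecIso (CommRingCat.of k)).inv y) = y := fun y => by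
      rw [← CommRingCat.comp_apply, Iso.inv_hom_id, CommRingCat.id_apply]
    rw [h5, Scheme.Hom.comp_appTop, CommRingCat.comp_apply,
      ← CommRingCat.comp_apply (Spec.map ev).appTop, Scheme.ΓSpecIso_naturality,
      CommRingCat.comp_apply] at h4
    exact h4
  change _ = (E a).evalAt x i
  rw [← h3, PolyEnd.map_comp, MvPolynomial.eval_map, eval₂_rename]
  rfl

end Geometry

section Geometry

variable {k : Type u} [Field k]

theorem Variety.Point.exists_factor {A : Variety k} (a : A.Point) {U : A.scheme.Opens}
    (hU : IsAffineOpen U) (ha : a.pt ∈ U) :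
    ∃ α : Γ(A.scheme, U) ⟶ CommRingCat.of k, a.1 = Spec.map α ≫ hU.fromSpec := by
  have hr : Set.range a.1 ⊆ Set.range hU.fromSpec := by
    rw [hU.range_fromSpec]
    rintro _ ⟨x, rfl⟩
    rw [show x = IsLocalRing.closedPoint k from Subsingleton.elim (α := PrimeSpectrum k) _ _]
    exact ha
  refine ⟨Spec.preimage (IsOpenImmersion.lift hU.fromSpec a.1 hr), ?_⟩
  rw [Spec.map_preimage, IsOpenImmersion.lift_fac]

theorem Variety.Point.pt_mem_basicOpen_iff {A : Variety k} (a : A.Point) {U : A.scheme.Opens}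
    (hU : IsAffineOpen U) {α : Γ(A.scheme, U) ⟶ CommRingCat.of k}
    (ha : a.1 = Spec.map α ≫ hU.fromSpec) (b : Γ(A.scheme, U)) :
    a.pt ∈ A.scheme.basicOpen b ↔ α b ≠ 0 := by
  have h1 : a.pt = hU.fromSpec (Spec.map α (IsLocalRing.closedPoint k)) := by
    rw [Variety.Point.pt, ha]
    rfl
  rw [h1, ← Scheme.Hom.mem_preimage, hU.fromSpec_preimage_basicOpen]
  change α b ∉ IsLocalRing.maximalIdeal k ↔ _
  rw [IsLocalRing.maximalIdeal_eq_bot]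
  rfl

end Geometry

/-! ### Closedness of the conjugacy class. -/

section Closed

variable {k : Type u} [Field k]

theorem isConjugator_of_eq {f g : PolyAut 2 k} {h : SAut 2 k} (hg : g = h * f * (h : PolyAut 2 k)⁻¹) :
    PolyEnd.IsConjugator (f : PolyEnd 2 k) (↑f⁻¹) g (↑g⁻¹) (h : PolyAut 2 k)
      (↑(h : PolyAut 2 k)⁻¹) where
  mul_inv := Units.mul_inv _
  inv_mul := Units.inv_mul _
  jac_eq_one := h.2
  semiconj := by
    rw [← Units.val_mul, ← Units.val_mul, hg]
    congr 1
    group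
  semiconj' := by
    rw [← Units.val_mul, ← Units.val_mul, hg]
    congr 1
    group

theorem PolyEnd.IsConjugator.exists_conj {f f' g : PolyAut 2 k} {g' h h' : PolyEnd 2 k}
    (H : IsConjugator (f : PolyEnd 2 k) f' g g' h h') :
    ∃ h : SAut 2 k, g = h * f * (h : PolyAut 2 k)⁻¹ := by
  refine ⟨⟨⟨h, h', H.mul_inv, H.inv_mul⟩, H.jac_eq_one⟩, ?_⟩
  rw [eq_mul_inv_iff_mul_eq]
  exact Units.ext H.semiconj

variable [IsAlgClosed k]

theorem DynamicallyRegular.exists_isTop {f : PolyAut 2 k} (hf : DynamicallyRegular f) :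
    ∃ l a l' a', (f : PolyEnd 2 k).IsTop l a ∧ (↑f⁻¹ : PolyEnd 2 k).IsTop l' a' ∧
      l 0 * l' 1 - l 1 * l' 0 ≠ 0 := by
  obtain ⟨l, a, h⟩ := PolyAut.exists_isTop f hf.1
  obtain ⟨l', a', h'⟩ := PolyAut.exists_isTop f⁻¹ (by rw [PolyAut.deg_inv]; exact hf.1)
  refine ⟨l, a, l', a', h, h', fun h0 => ?_⟩
  refine PolyEnd.eval_linForm_ne_zero_of_regular hf h h' (v := ![-l 1, l 0]) ?_ ?_ ?_
  · intro hv
    refine h.form_ne_zero (funext fun i => ?_)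
    fin_cases i
    · simpa using congrFun hv 1
    · simpa using congrFun hv 0
  · rw [eval_linForm]
    simp
    ring
  · rw [eval_linForm]
    simp
    linear_combination h0

theorem isClosed_setOf_conj (f : SAut 2 k) (hf : DynamicallyRegular (f : PolyAut 2 k)) :
    IsClosed {g : PolyAut 2 k | ∃ h : SAut 2 k, g = h * f * (h : PolyAut 2 k)⁻¹} := by
  rw [isClosed_polyAut_iff]
  rintro A F ⟨φ, -, hφ⟩
  have hφ' : ∀ (a : A.Point) (x : Fin 2 → k),
      a.pair x ≫ φ.inv = a.pair ((↑(F a)⁻¹ : PolyEnd 2 k).evalAt x) := by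
    intro a x
    have h := hφ a ((↑(F a)⁻¹ : PolyEnd 2 k).evalAt x)
    rw [← PolyEnd.evalAt_mul, Units.mul_inv] at h
    rw [Iso.comp_inv_eq, h]
    congr 1
    funext i
    exact (eval_X i).symm
  set C := {g : PolyAut 2 k | ∃ h : SAut 2 k, g = h * f * (h : PolyAut 2 k)⁻¹} with hC
  refine isClosed_of_closure_subset fun a₀ ha₀ => ?_
  obtain ⟨U, hU, haU, -⟩ := exists_isAffineOpen_mem_and_subset
    (TopologicalSpace.Opens.mem_top a₀.pt)
  obtain ⟨g, hg⟩ := exists_polyEnd_of_morphism φ.hom (fun a => (F a : PolyEnd 2 k)) hφ hU.fromSpec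
  obtain ⟨g', hg'⟩ := exists_polyEnd_of_morphism φ.inv (fun a => (↑(F a)⁻¹ : PolyEnd 2 k)) hφ'
    hU.fromSpec
  obtain ⟨ι, hι⟩ : ∃ ι, Spec.map ι = hU.fromSpec ≫ A.str := ⟨_, Spec.map_preimage _⟩
  have hια : ∀ (a : A.Point) (α : Γ(A.scheme, U) ⟶ CommRingCat.of k),
      a.1 = Spec.map α ≫ hU.fromSpec → α.hom.comp ι.hom = RingHom.id k := by
    intro a α ha
    have h1 : Spec.map (ι ≫ α) = Spec.map (𝟙 (CommRingCat.of k)) := by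
      rw [Spec.map_comp, hι, ← Category.assoc, ← ha, a.2, Spec.map_id]
    exact congrArg CommRingCat.Hom.hom (Spec.map_injective h1)
  let S : Set (Γ(A.scheme, U) →+* k) := {γ | ∃ a : A.Point, F a ∈ C ∧
    a.1 = Spec.map (CommRingCat.ofHom γ) ≫ hU.fromSpec}
  obtain ⟨α, hα⟩ := a₀.exists_factor hU haU
  obtain ⟨l, b, l', b', hl, hl', hll'⟩ := hf.exists_isTop
  -- The bound `g.deg` works because every specialisation of `g` has at most this degree, and by (1)
  -- so does a suitable conjugator.
  have key := PolyEnd.IsConjugator.exists_of_closure (ι := ι.hom) (g := g) (g' := g') hl hl' hf.1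
    (by rw [PolyAut.deg_inv]; exact hf.1) hll' g.deg S ?_ α.hom (hια a₀ α hα) ?_
  · obtain ⟨h, h', H⟩ := key
    rw [hg a₀ α hα, hg' a₀ α hα] at H
    exact H.exists_conj
  · rintro γ ⟨a, ⟨h, hh⟩, ha⟩
    refine ⟨hια a _ ha, ?_⟩
    obtain ⟨p, hp, hpd⟩ := exists_conj_deg_sq_le f hf (h * f * h⁻¹) (isConj_iff.2 ⟨h, rfl⟩)
    have hFa : F a = p * f * (p : PolyAut 2 k)⁻¹ := by
      rw [hh]
      exact congrArg Subtype.val hp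
    have hga := hg a _ ha
    have hd : ((p : PolyAut 2 k) : PolyEnd 2 k).deg ≤ g.deg := by
      refine (Nat.le_self_pow two_ne_zero _).trans (hpd.trans ?_)
      refine le_trans (le_of_eq ?_) (g.deg_map_le γ)
      exact congrArg PolyEnd.deg ((congrArg Units.val hh).symm.trans hga.symm)
    refine ⟨_, _, ?_, hd, by rwa [PolyAut.deg_inv]⟩
    have H := isConjugator_of_eq hFa
    rw [← hga, ← hg' a _ ha] at H
    exact H
  -- A function not vanishing at `a₀` has a basic open neighbourhood of `a₀` as nonvanishing locus,
  -- and this meets the preimage of the class.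
  · intro c hc
    by_contra hne
    have hmem := (a₀.pt_mem_basicOpen_iff hU hα c).2 hne
    obtain ⟨a, ha, haC⟩ := mem_closure_iff.1 ha₀ 
      (Variety.Point.pt ⁻¹' (A.scheme.basicOpen c : Set A.scheme))
      (isOpen_induced (A.scheme.basicOpen c).isOpen) (Set.mem_preimage.2 hmem)
    obtain ⟨γ, hγ⟩ := a.exists_factor hU (A.scheme.basicOpen_le c ha)
    exact (a.pt_mem_basicOpen_iff hU hγ c).1 ha (hc γ.hom ⟨a, haC, hγ⟩)

end Closed

end Scheme

end AffineAut

end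

theorem mainTheorem4 {k : Type u} [Field k] [IsAlgClosed k]
    (f : AffineAut.SAut 2 k) (hf : AffineAut.DynamicallyRegular (f : AffineAut.PolyAut 2 k)) :
    (∀ g : AffineAut.SAut 2 k, IsConj f g →
      ∃ h : AffineAut.SAut 2 k, g = h * f * h⁻¹ ∧
        ((h : AffineAut.PolyAut 2 k) : AffineAut.PolyEnd 2 k).deg ^ 2 ≤
          ((g : AffineAut.PolyAut 2 k) : AffineAut.PolyEnd 2 k).deg) ∧
    IsClosed {g : AffineAut.SAut 2 k | IsConj f g} := by
  refine ⟨fun g hg => AffineAut.exists_conj_deg_sq_le f hf g hg, ?_⟩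
  have h := (AffineAut.isClosed_setOf_conj f hf).preimage (f := ((↑) : AffineAut.SAut 2 k → AffineAut.PolyAut 2 k))
    continuous_subtype_val
  convert! h using 1
  ext g
  rw [Set.mem_preimage, Set.mem_ofPred_eq, Set.mem_ofPred_eq, isConj_iff]
  exact exists_congr fun c => ⟨fun h => (congrArg Subtype.val h).symm, fun h => Subtype.ext h.symm⟩
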